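/- **Setting.** For each $n$ let $p=p_n\ge 1$ and let $\Sigma_0=\Sigma_{0,n}$ be a $p\times p$ covariance matrix with arbitrary (unknown) variances. Let $X^{(1)},\dots,X^{(n)}$ be i.i.d. $N_p(0,\Sigma_0)$, and put $\Theta_0=\Sigma_0^{-1}=(\theta_{0,ij})$, $\sigma_{\max}^2=\max_i\Sigma_{0,ii}$, $\sigma_{\min}^2=\min_i\Sigma_{0,ii}$. Let $\Psi_0=\mathrm{diag}(\Sigma_0)^{-1/2}\,\Sigma_0\,\mathrm{diag}(\Sigma_0)^{-1/2}$ be the correlation matrix and $\Omega_0=\Psi_0^{-1}$. Let $\hat S_n=\frac1n\sum_r X^{(r)}(X^{(r)})^T$ and let $\hat\Gamma_n=\mathrm{diag}(\hat S_n)^{-1/2}\hat S_n\,\mathrm{diag}(\hat S_n)^{-1/2}$ be the sample correlation matrix. Write $\|A\|_F=(\sum_{i,j}a_{ij}^2)^{1/2}$. With $\lambda=\sqrt{2\log p/n}$, let $s^i_{0,n}$ be the smallest non-negative integer $s$ with $\sum_{j\ne i}\min\{\theta_{0,ij}^2,\lambda^2\theta_{0,ii}\}\le s\,\lambda^2\theta_{0,ii}$,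 and let $S_{0,n}=\sum_{i=1}^p s^i_{0,n}$. Assume * (A1) $p=o(e^{cn})$ for some constant $0<c<1$, and $S_{0,n}=o(n/\log\max(n,p))$ as $n\to\infty$; * (A2) there are constants $0<M_{\mathrm{low}}\le M_{\mathrm{upp}}$ such that, for every $n$, all eigenvalues of $\Sigma_0$ lie in $[M_{\mathrm{low}},M_{\mathrm{upp}}]$; moreover $1/\theta_{0,ii}\ge v^2$ for all $i$ and $n$, for some constant $v>0$. The lower bound is normalized so that $M_{\mathrm{low}}\le 1$. An edge set $E$ is a set of undirected edges $\{i,j\}$, $i\neq j$, on $\{1,\dots,p\}$, and $|E|$ is the number of its edges. Let $E_0$ be the set of edges $\{i,j\}$ with $\theta_{0,ij}\ne0$. For an edge set $E$ let $\tilde\Theta_0$ be the matrix that agrees with $\Theta_0$ on the diagonal and at the positions of the edges of $E\cap E_0$, and is zero elsewhere. Let $$\hat\Omega_n(E)=\arg\min\big\{\mathrm{tr}(\Omega\hat\Gamma_n)-\log|\Omega| \;:\; \Omega\succ0,\ \Omega_{ij}=0\ \text{whenever } i\ne j \text{ and } \{i,j\}\notin E\big\}.$$ **Theorem.** Let $d$,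 $L$, $C_{\mathrm{bias}}$ and $C_3\ge4\sqrt{5/3}$ be real constants. Let $\mathcal E$ be an event with $\mathbb P(\mathcal E)\ge1-d/p^2$ and let $E$ be a (possibly random) edge set such that, on $\mathcal E$, 1. $|E|\le L\,S_{0,n}$; 2. $\|\tilde\Theta_0-\Theta_0\|_F\le C_{\mathrm{bias}}\sqrt{2S_{0,n}\log p/n}$; 3. the sample size satisfies $$n>\frac{144\,\sigma_{\max}^4}{M_{\mathrm{low}}^2}\Big(4C_3+\frac{13M_{\mathrm{upp}}}{12\sigma_{\min}^2}\Big)^2\max\big\{2|E|\log\max(n,p),\;C_{\mathrm{bias}}^2\,2S_{0,n}\log p\big\}.$$ Put $M=\dfrac{9\sigma_{\max}^4}{2M_{\mathrm{low}}^2}\Big(4C_3+\dfrac{13M_{\mathrm{upp}}}{12\sigma_{\min}^2}\Big)$. Then with probability at least $1-(d+1)/p^2$ the minimizer $\hat\Omega_n(E)$ exists, is unique, and satisfies $$\|\hat\Omega_n(E)-\Omega_0\|_F\le(M+1)\max\Big\{\sqrt{2|E|\log\max(n,p)/n},\;C_{\mathrm{bias}}\sqrt{2S_{0,n}\log p/n}\Big\}.$$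 -/

import Mathlib

open MeasureTheory ProbabilityTheory Filter Asymptotics
open scoped Matrix

noncomputable section

namespace GaussGraph

/-- Frobenius norm `√(∑ i, ∑ j, a_ij²)`. -/
def frobNorm {p : ℕ} (A : Matrix (Fin p) (Fin p) ℝ) : ℝ :=
  √(∑ i, ∑ j, A i j ^ 2)

/-- The correlation matrix of a matrix `S`: `diag(S)^{-1/2} S diag(S)^{-1/2}`. -/
def corrMatrix {p : ℕ} (S : Matrix (Fin p) (Fin p) ℝ) : Matrix (Fin p) (Fin p) ℝ :=
  Matrix.of fun i j => S i j / (√(S i i) * √(S j j))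

/-- The sample covariance `n⁻¹ ∑ r, x^(r) (x^(r))ᵀ` (the mean is known to be zero). -/
def sampleCov {p n : ℕ} (x : Fin n → EuclideanSpace ℝ (Fin p)) : Matrix (Fin p) (Fin p) ℝ :=
  Matrix.of fun i j => (∑ r, x r i * x r j) / (n : ℝ)

/-- `λ = √(2 log p / n)`. -/
def lam (p n : ℕ) : ℝ := √(2 * Real.log p / n)

/-- The essential sparsity of row `i` of the concentration matrix `Θ`: the smallest `s` with
`∑_{j ≠ i} min (θ_ij²) (λ² θ_ii) ≤ s λ² θ_ii`. -/
def rowSparsity {p : ℕ} (n : ℕ) (Θ : Matrix (Fin p) (Fin p) ℝ) (i : Fin p) : ℕ :=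
  sInf {s : ℕ | ∑ j ∈ Finset.univ.erase i, min (Θ i j ^ 2) (lam p n ^ 2 * Θ i i)
    ≤ (s : ℝ) * (lam p n ^ 2 * Θ i i)}

/-- The total essential sparsity `S_{0,n}`. -/
def essSparsity {p : ℕ} (n : ℕ) (Θ : Matrix (Fin p) (Fin p) ℝ) : ℕ :=
  ∑ i, rowSparsity n Θ i

/-- The conditional independence graph: an edge `i — j` (`i ≠ j`) iff `θ_ij ≠ 0`. -/
def ciGraph {p : ℕ} (Θ : Matrix (Fin p) (Fin p) ℝ) : SimpleGraph (Fin p) :=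
  SimpleGraph.fromRel fun i j => Θ i j ≠ 0

open Classical in
/-- `diag(Θ) + Θ_G`: keep the diagonal and the entries on edges of `G`, delete the others. -/
def keepEdges {p : ℕ} (Θ : Matrix (Fin p) (Fin p) ℝ) (G : SimpleGraph (Fin p)) :
    Matrix (Fin p) (Fin p) ℝ :=
  Matrix.of fun i j => if i = j ∨ G.Adj i j then Θ i j else 0

/-- The number of (undirected) edges. -/
def numEdges {p : ℕ} (G : SimpleGraph (Fin p)) : ℕ := G.edgeSet.ncard

/-- Symmetric positive definite matrices vanishing at all off-diagonal positions outside `G`. -/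
def feasible {p : ℕ} (G : SimpleGraph (Fin p)) : Set (Matrix (Fin p) (Fin p) ℝ) :=
  {A | A.PosDef ∧ ∀ i j, i ≠ j → ¬ G.Adj i j → A i j = 0}

/-- The empirical risk `tr(A Γ) - log |A|`. -/
def empRisk {p : ℕ} (Γ A : Matrix (Fin p) (Fin p) ℝ) : ℝ :=
  (A * Γ).trace - Real.log A.det

/-- `A` is a maximum likelihood estimate constrained to `G`: a minimizer of the empirical risk
over the feasible set. -/
def IsMLE {p : ℕ} (G : SimpleGraph (Fin p)) (Γ A : Matrix (Fin p) (Fin p) ℝ) : Prop :=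
  A ∈ feasible G ∧ IsMinOn (empRisk Γ) (feasible G) A

/-- The largest variance. -/
def maxVar {p : ℕ} (S : Matrix (Fin p) (Fin p) ℝ) : ℝ := ⨆ i, S i i

/-- The smallest variance. -/
def minVar {p : ℕ} (S : Matrix (Fin p) (Fin p) ℝ) : ℝ := ⨅ i, S i i

/-- Growth of the dimension and of the total essential sparsity along the triangular array of
covariance matrices `Sig n`. -/
def AssumptionA1 (p : ℕ → ℕ) (Sig : ∀ n, Matrix (Fin (p n)) (Fin (p n)) ℝ) : Prop :=
  (∃ c : ℝ, 0 < c ∧ c < 1 ∧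
    (fun n : ℕ => (p n : ℝ)) =o[atTop] fun n : ℕ => Real.exp (c * n)) ∧
  (fun n : ℕ => (essSparsity n (Sig n)⁻¹ : ℝ)) =o[atTop]
    fun n : ℕ => (n : ℝ) / Real.log (max n (p n) : ℕ)

/-- All eigenvalues of the covariance matrices lie in `[Mlow, Mupp]`, and the residual variances
`1 / θ_ii` of the nodewise regressions are bounded away from zero. -/
def AssumptionA2 (p : ℕ → ℕ) (Sig : ∀ n, Matrix (Fin (p n)) (Fin (p n)) ℝ)
    (Mlow Mupp : ℝ) : Prop :=
  0 < Mlow ∧ Mlow ≤ Mupp ∧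
  (∀ n, ∃ h : (Sig n).IsHermitian, ∀ i, Mlow ≤ h.eigenvalues i ∧ h.eigenvalues i ≤ Mupp) ∧
  ∃ v : ℝ, 0 < v ∧ ∀ n i, v ^ 2 ≤ 1 / (Sig n)⁻¹ i i

end GaussGraph

end

/-! Let `Q` be the population correlation matrix, factored as `Q = Sᵀ * S`, and whiten a candidate
`A` to `Z = S * A * Sᵀ`. Its excess risk over `Q⁻¹` is exactly the linear term tr((A - Q⁻¹)(G - Q))
plus tr(Z - 1) - log det Z (`empRisk_sub_empRisk_inv`). With T the Frobenius norm of Z - 1, the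
second part is at least T²/(2(1+T)) for every positive definite Z (`le_trace_sub_log_det`), and at
most T² once T ≤ 1/2 (`trace_sub_log_det_le`).

The lower bound is global, so no localization is needed. The comparison point `A₀` is the truncated
concentration matrix rescaled by the standard deviations. A feasible `A` with risk at most that of
`A₀` satisfies a scalar inequality forcing T to be small. Hence the sublevel set lies in a compact
set of positive definite matrices, which gives existence and the rate together
(`exists_isMLE_frobNorm_le`); strict convexity gives uniqueness.

In this comparison the linear term involves only `A - A₀`, supported on `E` and the diagonal.
Correlation matrices have unit diagonal, so Cauchy–Schwarz leaves √(2|E|) times the largest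
entrywise error (`abs_trace_mul_le`). That error is controlled for all entries at once, whence `E`
may be random: polarization reduces products to squares of Gaussians, and a Chernoff and union bound
finish (`measureReal_not_pairsConcentrated_le`). -/

namespace GaussGraph

/-! ### Scalar inequalities -/

lemma log_le_half_sub_inv {u : ℝ} (hu : 1 ≤ u) : Real.log u ≤ (u - u⁻¹) / 2 := by
  rw [← Real.sinh_log (by linarith)]
  exact Real.self_le_sinh_iff.2 (Real.log_nonneg hu)

/-- For y ≥ 0 this is the sinh bound at 1 + y. For y ≤ 0, log(1 + x) ≥ 2x/(x + 2) is used at x =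
-y/(1 + y), where 1 + x = 1/(1 + y). Linear growth in |y| is what later removes any a priori bound
on eigenvalues. -/
lemma sq_div_le_sub_log_one_add {y : ℝ} (hy : -1 < y) :
    y ^ 2 / (2 * (1 + |y|)) ≤ y - Real.log (1 + y) := by
  rcases le_total 0 y with h | h
  · rw [abs_of_nonneg h]
    have h1 := log_le_half_sub_inv (u := 1 + y) (by linarith)
    have h2 : y ^ 2 / (2 * (1 + y)) = y - (1 + y - (1 + y)⁻¹) / 2 := by
      field_simp
      ring
    linarith
  · rw [abs_of_nonpos h]
    have h0 : 0 < 1 + y := by linarith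
    have h1 := Real.le_log_one_add_of_nonneg (x := -y / (1 + y))
      (div_nonneg (by linarith) h0.le)
    have h2 : 1 + -y / (1 + y) = (1 + y)⁻¹ := by field_simp; ring
    have h3 : 2 * (-y / (1 + y)) / (-y / (1 + y) + 2) = -(2 * y / (2 + y)) := by
      have : 2 + y ≠ 0 := by linarith
      have : -y / (1 + y) + 2 = (2 + y) / (1 + y) := by field_simp; ring
      rw [this]
      field_simp
    rw [h2, h3, Real.log_inv] at h1
    have h4 : y ^ 2 / (2 + y) = y - 2 * y / (2 + y) := by
      have : 2 + y ≠ 0 := by linarith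
      field_simp
      ring
    have h5 : y ^ 2 / (2 * (1 + -y)) ≤ y ^ 2 / (2 + y) :=
      div_le_div_of_nonneg_left (sq_nonneg y) (by linarith) (by linarith)
    linarith

lemma sub_log_one_add_le_sq {y : ℝ} (hy : -(1 / 2) ≤ y) : y - Real.log (1 + y) ≤ y ^ 2 := by
  rcases le_total 0 y with h | h
  · have h1 := Real.le_log_one_add_of_nonneg h
    have h2 : y - y ^ 2 ≤ 2 * y / (y + 2) := by
      rw [le_div_iff₀ (by linarith)]
      nlinarith [mul_nonneg h h, pow_nonneg h 3]
    linarith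
  · have h0 : 0 < 1 + y := by linarith
    have h1 := log_le_half_sub_inv (u := (1 + y)⁻¹) ((one_le_inv₀ h0).2 (by linarith))
    rw [Real.log_inv, inv_inv] at h1
    have h2 : ((1 + y)⁻¹ - (1 + y)) / 2 ≤ -y + y ^ 2 := by
      rw [div_le_iff₀ two_pos, sub_le_iff_le_add, inv_le_iff_one_le_mul₀ h0]
      nlinarith [mul_nonneg (sq_nonneg y) (by linarith : 0 ≤ 1 + 2 * y)]
    linarith

/-! ### The Frobenius norm -/

variable {p : ℕ}

lemma frobNorm_nonneg (A : Matrix (Fin p) (Fin p) ℝ) : 0 ≤ frobNorm A := Real.sqrt_nonneg _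

lemma frobNorm_sq (A : Matrix (Fin p) (Fin p) ℝ) : frobNorm A ^ 2 = ∑ i, ∑ j, A i j ^ 2 :=
  Real.sq_sqrt (Finset.sum_nonneg fun _ _ => Finset.sum_nonneg fun _ _ => sq_nonneg _)

lemma frobNorm_transpose (A : Matrix (Fin p) (Fin p) ℝ) : frobNorm Aᵀ = frobNorm A := by
  unfold frobNorm
  rw [Finset.sum_comm]
  rfl

lemma abs_apply_le_frobNorm (A : Matrix (Fin p) (Fin p) ℝ) (i j : Fin p) :
    |A i j| ≤ frobNorm A := by
  refine abs_le_of_sq_le_sq ?_ (frobNorm_nonneg A)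
  rw [frobNorm_sq]
  exact (Finset.single_le_sum (f := fun j => A i j ^ 2) (fun _ _ => sq_nonneg _)
    (Finset.mem_univ j)).trans (Finset.single_le_sum (f := fun i => ∑ j, A i j ^ 2)
    (fun _ _ => Finset.sum_nonneg fun _ _ => sq_nonneg _) (Finset.mem_univ i))

lemma eq_zero_of_frobNorm_eq_zero {A : Matrix (Fin p) (Fin p) ℝ} (h : frobNorm A = 0) : A = 0 := by
  ext i j
  have := abs_apply_le_frobNorm A i j
  rw [h] at this
  exact abs_nonpos_iff.1 this

lemma abs_sum_mul_le_frobNorm (A B : Matrix (Fin p) (Fin p) ℝ) :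
    |∑ i, ∑ j, A i j * B i j| ≤ frobNorm A * frobNorm B := by
  refine abs_le_of_sq_le_sq ?_ (mul_nonneg (frobNorm_nonneg A) (frobNorm_nonneg B))
  rw [mul_pow, frobNorm_sq, frobNorm_sq]
  simp only [← Fintype.sum_prod_type']
  exact Finset.sum_mul_sq_le_sq_mul_sq _ _ _

lemma frobNorm_add_le (A B : Matrix (Fin p) (Fin p) ℝ) :
    frobNorm (A + B) ≤ frobNorm A + frobNorm B := by
  refine abs_le_of_sq_le_sq' ?_ (add_nonneg (frobNorm_nonneg A) (frobNorm_nonneg B)) |>.2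
  have h := (le_abs_self _).trans (abs_sum_mul_le_frobNorm A B)
  have h2 : frobNorm (A + B) ^ 2 =
      frobNorm A ^ 2 + 2 * (∑ i, ∑ j, A i j * B i j) + frobNorm B ^ 2 := by
    simp only [frobNorm_sq, Finset.mul_sum, ← Finset.sum_add_distrib, Matrix.add_apply]
    refine Finset.sum_congr rfl fun i _ => Finset.sum_congr rfl fun j _ => ?_
    ring
  nlinarith

lemma frobNorm_sub_le (A B : Matrix (Fin p) (Fin p) ℝ) :
    frobNorm (A - B) ≤ frobNorm A + frobNorm B := by
  have h : frobNorm (-B) = frobNorm B := by simp [frobNorm]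
  simpa [sub_eq_add_neg, h] using frobNorm_add_le A (-B)

lemma frobNorm_mul_sq_le {N : Matrix (Fin p) (Fin p) ℝ} {c : ℝ}
    (hN : ∀ x : Fin p → ℝ, (N *ᵥ x) ⬝ᵥ (N *ᵥ x) ≤ c * (x ⬝ᵥ x)) (B : Matrix (Fin p) (Fin p) ℝ) :
    frobNorm (N * B) ^ 2 ≤ c * frobNorm B ^ 2 := by
  rw [frobNorm_sq, frobNorm_sq, Finset.sum_comm, Finset.sum_comm (f := fun i j => B i j ^ 2),
    Finset.mul_sum]
  refine Finset.sum_le_sum fun j _ => ?_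
  have h := hN (fun i => B i j)
  simpa [dotProduct, Matrix.mulVec, Matrix.mul_apply, sq] using h

/-- Left multiplication acts column by column; transposing between two left multiplications handles
the right factor. -/
lemma frobNorm_congr_le {N : Matrix (Fin p) (Fin p) ℝ} {c : ℝ} (hc : 0 ≤ c)
    (hN : ∀ x : Fin p → ℝ, (N *ᵥ x) ⬝ᵥ (N *ᵥ x) ≤ c * (x ⬝ᵥ x)) (B : Matrix (Fin p) (Fin p) ℝ) :
    frobNorm (N * B * Nᵀ) ≤ c * frobNorm B := by
  refine abs_le_of_sq_le_sq' ?_ (mul_nonneg hc (frobNorm_nonneg B)) |>.2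
  calc frobNorm (N * B * Nᵀ) ^ 2 = frobNorm (N * (N * B)ᵀ) ^ 2 := by
        rw [← frobNorm_transpose, Matrix.transpose_mul, Matrix.transpose_transpose]
    _ ≤ c * frobNorm (N * B) ^ 2 := by
        rw [← frobNorm_transpose (N * B)]
        exact frobNorm_mul_sq_le hN (N * B)ᵀ
    _ ≤ c * (c * frobNorm B ^ 2) := mul_le_mul_of_nonneg_left (frobNorm_mul_sq_le hN B) hc
    _ = (c * frobNorm B) ^ 2 := by ring

/-! ### The log-determinant remainder -/

lemma trace_sq_eq_sum_eigenvalues_sq {Z : Matrix (Fin p) (Fin p) ℝ} (hZ : Z.IsHermitian) :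
    (Z * Z).trace = ∑ i, hZ.eigenvalues i ^ 2 := by
  conv_lhs => rw [hZ.spectral_theorem]
  rw [← map_mul, Matrix.diagonal_mul_diagonal, Unitary.conjStarAlgAut_apply,
    Matrix.trace_mul_cycle, Unitary.coe_star_mul_self, one_mul, Matrix.trace_diagonal]
  simp [sq]

lemma frobNorm_sub_one_sq {Z : Matrix (Fin p) (Fin p) ℝ} (hZ : Z.IsHermitian) :
    frobNorm (Z - 1) ^ 2 = ∑ i, (hZ.eigenvalues i - 1) ^ 2 := by
  have h1 : frobNorm (Z - 1) ^ 2 = ((Z - 1) * (Z - 1)).trace := by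
    rw [frobNorm_sq]
    simp only [Matrix.trace, Matrix.diag_apply, Matrix.mul_apply, sq]
    refine Finset.sum_congr rfl fun i _ => Finset.sum_congr rfl fun j _ => ?_
    have : (Z - 1) j i = (Z - 1) i j := by
      simpa using (hZ.sub Matrix.isHermitian_one).apply i j
    rw [this]
  have h2 : (Z - 1) * (Z - 1) = Z * Z - Z - Z + 1 := by noncomm_ring
  have h3 := hZ.trace_eq_sum_eigenvalues
  simp only [RCLike.ofReal_real_eq_id, id_eq] at h3
  rw [h1, h2, Matrix.trace_add, Matrix.trace_sub, Matrix.trace_sub,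
    trace_sq_eq_sum_eigenvalues_sq hZ, h3, Matrix.trace_one]
  simp only [sub_sq, Finset.sum_add_distrib, Finset.sum_sub_distrib, ← Finset.mul_sum,
    ← Finset.sum_mul]
  simp
  ring

lemma trace_sub_log_det_eq {Z : Matrix (Fin p) (Fin p) ℝ} (hZ : Z.PosDef) :
    (Z - 1).trace - Real.log Z.det =
      ∑ i, ((hZ.1.eigenvalues i - 1) - Real.log (1 + (hZ.1.eigenvalues i - 1))) := by
  have h3 := hZ.1.trace_eq_sum_eigenvalues
  have h4 := hZ.1.det_eq_prod_eigenvalues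
  simp only [RCLike.ofReal_real_eq_id, id_eq] at h3 h4
  rw [Matrix.trace_sub, h3, h4, Real.log_prod (fun i _ => (hZ.eigenvalues_pos i).ne')]
  simp [Finset.sum_sub_distrib]

lemma abs_eigenvalues_sub_one_le {Z : Matrix (Fin p) (Fin p) ℝ} (hZ : Z.IsHermitian) (i : Fin p) :
    |hZ.eigenvalues i - 1| ≤ frobNorm (Z - 1) := by
  refine abs_le_of_sq_le_sq ?_ (frobNorm_nonneg _)
  rw [frobNorm_sub_one_sq hZ]
  exact Finset.single_le_sum (f := fun i => (hZ.eigenvalues i - 1) ^ 2)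
    (fun _ _ => sq_nonneg _) (Finset.mem_univ i)

/-- The scalar bound is summed over eigenvalues. Each |λ - 1| is at most the Frobenius norm, so all
denominators can be replaced by a common one. -/
lemma le_trace_sub_log_det {Z : Matrix (Fin p) (Fin p) ℝ} (hZ : Z.PosDef) :
    frobNorm (Z - 1) ^ 2 / (2 * (1 + frobNorm (Z - 1))) ≤ (Z - 1).trace - Real.log Z.det := by
  have h0 := frobNorm_nonneg (Z - 1)
  rw [trace_sub_log_det_eq hZ, frobNorm_sub_one_sq hZ.1, Finset.sum_div]
  refine Finset.sum_le_sum fun i _ => ?_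
  refine le_trans ?_ (sq_div_le_sub_log_one_add (by linarith [hZ.eigenvalues_pos i]))
  have h := abs_eigenvalues_sub_one_le hZ.1 i
  exact div_le_div_of_nonneg_left (sq_nonneg _) (by positivity) (by linarith)

lemma trace_sub_log_det_le {Z : Matrix (Fin p) (Fin p) ℝ} (hZ : Z.PosDef)
    (h : frobNorm (Z - 1) ≤ 1 / 2) :
    (Z - 1).trace - Real.log Z.det ≤ frobNorm (Z - 1) ^ 2 := by
  rw [trace_sub_log_det_eq hZ, frobNorm_sub_one_sq hZ.1]
  refine Finset.sum_le_sum fun i _ => sub_log_one_add_le_sq ?_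
  have := (abs_le.1 ((abs_eigenvalues_sub_one_le hZ.1 i).trans h)).1
  linarith

lemma posDef_of_frobNorm_sub_one_lt {Z : Matrix (Fin p) (Fin p) ℝ} (hZ : Z.IsHermitian)
    (h : frobNorm (Z - 1) < 1) : Z.PosDef := by
  rw [hZ.posDef_iff_eigenvalues_pos]
  intro i
  have := (abs_le.1 (abs_eigenvalues_sub_one_le hZ i)).1
  linarith

end GaussGraph

namespace GaussGraph

variable {p : ℕ}

/-! ### The constrained likelihood in whitened coordinates -/

open scoped MatrixOrder in
lemma exists_transpose_mul_self_eq {Q : Matrix (Fin p) (Fin p) ℝ} (hQ : Q.PosDef) :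
    ∃ S : Matrix (Fin p) (Fin p) ℝ, IsUnit S ∧ Q = Sᵀ * S := by
  obtain ⟨S, hS⟩ := CStarAlgebra.nonneg_iff_eq_star_mul_self.mp hQ.posSemidef.nonneg
  rw [Matrix.star_eq_conjTranspose, Matrix.conjTranspose_eq_transpose_of_trivial] at hS
  refine ⟨S, ?_, hS⟩
  rw [Matrix.isUnit_iff_isUnit_det, isUnit_iff_ne_zero]
  have h := hQ.det_pos
  rw [hS, Matrix.det_mul] at h
  exact right_ne_zero_of_mul h.ne'

lemma whiten_inv {S : Matrix (Fin p) (Fin p) ℝ} (hS : IsUnit S) : S * (Sᵀ * S)⁻¹ * Sᵀ = 1 := by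
  have h := (Matrix.isUnit_iff_isUnit_det S).1 hS
  have h' : IsUnit Sᵀ.det := by rwa [Matrix.det_transpose]
  rw [Matrix.mul_inv_rev, ← mul_assoc, Matrix.mul_nonsing_inv _ h, one_mul,
    Matrix.nonsing_inv_mul _ h']

lemma posDef_whiten_iff {S : Matrix (Fin p) (Fin p) ℝ} (hS : IsUnit S)
    {A : Matrix (Fin p) (Fin p) ℝ} : (S * A * Sᵀ).PosDef ↔ A.PosDef := by
  have := Matrix.IsUnit.posDef_star_right_conjugate_iff (x := A) hS
  rwa [Matrix.star_eq_conjTranspose, Matrix.conjTranspose_eq_transpose_of_trivial] at this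

lemma whiten_sub {S : Matrix (Fin p) (Fin p) ℝ} (hS : IsUnit S) (A : Matrix (Fin p) (Fin p) ℝ) :
    S * (A - (Sᵀ * S)⁻¹) * Sᵀ = S * A * Sᵀ - 1 := by
  rw [mul_sub, sub_mul, whiten_inv hS]

lemma unwhiten {S : Matrix (Fin p) (Fin p) ℝ} (hS : IsUnit S) (H : Matrix (Fin p) (Fin p) ℝ) :
    S⁻¹ * (S * H * Sᵀ) * (S⁻¹)ᵀ = H := by
  have h := (Matrix.isUnit_iff_isUnit_det S).1 hS
  have h' : IsUnit Sᵀ.det := by rwa [Matrix.det_transpose]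
  calc S⁻¹ * (S * H * Sᵀ) * (S⁻¹)ᵀ = (S⁻¹ * S) * H * (Sᵀ * (S⁻¹)ᵀ) := by noncomm_ring
    _ = H := by
      rw [Matrix.nonsing_inv_mul _ h, Matrix.transpose_nonsing_inv, Matrix.mul_nonsing_inv _ h',
        one_mul, mul_one]

lemma dotProduct_mulVec_self (S : Matrix (Fin p) (Fin p) ℝ) (x : Fin p → ℝ) :
    (S *ᵥ x) ⬝ᵥ (S *ᵥ x) = x ⬝ᵥ ((Sᵀ * S) *ᵥ x) := by
  rw [← Matrix.mulVec_mulVec, Matrix.dotProduct_mulVec x, Matrix.vecMul_transpose]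

lemma frobNorm_whiten_le {S : Matrix (Fin p) (Fin p) ℝ} {V : ℝ} (hV0 : 0 ≤ V)
    (hV : ∀ x : Fin p → ℝ, x ⬝ᵥ ((Sᵀ * S) *ᵥ x) ≤ V * (x ⬝ᵥ x)) (H : Matrix (Fin p) (Fin p) ℝ) :
    frobNorm (S * H * Sᵀ) ≤ V * frobNorm H :=
  frobNorm_congr_le hV0 (fun x => by rw [dotProduct_mulVec_self]; exact hV x) H

lemma frobNorm_le_whiten {S : Matrix (Fin p) (Fin p) ℝ} (hS : IsUnit S) {U : ℝ} (hU0 : 0 ≤ U)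
    (hU : ∀ x : Fin p → ℝ, x ⬝ᵥ x ≤ U * (x ⬝ᵥ ((Sᵀ * S) *ᵥ x))) (H : Matrix (Fin p) (Fin p) ℝ) :
    frobNorm H ≤ U * frobNorm (S * H * Sᵀ) := by
  have h := frobNorm_congr_le (N := S⁻¹) hU0 (fun x => ?_) (S * H * Sᵀ)
  · rwa [unwhiten hS] at h
  · refine (hU (S⁻¹ *ᵥ x)).trans_eq ?_
    rw [← dotProduct_mulVec_self, Matrix.mulVec_mulVec,
      Matrix.mul_nonsing_inv _ ((Matrix.isUnit_iff_isUnit_det S).1 hS), Matrix.one_mulVec]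

/-- An identity with no Taylor error: tr Z = tr(AQ) and det Z = det A · det Q. -/
lemma empRisk_sub_empRisk_inv {S : Matrix (Fin p) (Fin p) ℝ} (hS : IsUnit S)
    (G : Matrix (Fin p) (Fin p) ℝ) {A : Matrix (Fin p) (Fin p) ℝ} (hA : A.PosDef) :
    empRisk G A - empRisk G (Sᵀ * S)⁻¹ = ((A - (Sᵀ * S)⁻¹) * (G - Sᵀ * S)).trace +
      ((S * A * Sᵀ - 1).trace - Real.log (S * A * Sᵀ).det) := by
  have h := (Matrix.isUnit_iff_isUnit_det S).1 hS
  have h' : IsUnit (Sᵀ * S).det := by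
    rw [Matrix.det_mul, Matrix.det_transpose]; exact h.mul h
  have ht : (S * A * Sᵀ).trace = (A * (Sᵀ * S)).trace := by
    rw [mul_assoc, Matrix.trace_mul_comm, mul_assoc]
  have hd : (S * A * Sᵀ).det = A.det * (Sᵀ * S).det := by
    simp only [Matrix.det_mul, Matrix.det_transpose]; ring
  have hi : (Sᵀ * S)⁻¹.det = (Sᵀ * S).det⁻¹ := by
    rw [Matrix.det_nonsing_inv, Ring.inverse_eq_inv']
  unfold empRisk
  rw [sub_mul, mul_sub, mul_sub, Matrix.nonsing_inv_mul _ h', hd, hi,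
    Real.log_mul hA.det_pos.ne' h'.ne_zero, Real.log_inv]
  simp only [Matrix.trace_sub, ht]
  ring

lemma trace_mul_eq_sum {A G : Matrix (Fin p) (Fin p) ℝ} (hG : G.IsHermitian) :
    (A * G).trace = ∑ i, ∑ j, A i j * G i j := by
  simp only [Matrix.trace, Matrix.diag_apply, Matrix.mul_apply]
  refine Finset.sum_congr rfl fun i _ => Finset.sum_congr rfl fun j _ => ?_
  have := hG.apply i j
  simp only [star_trivial] at this
  rw [this]

/-! ### Strict convexity of the risk -/

/-- Expanding around the midpoint, the two linear terms cancel and both log-determinant remainders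
are strictly positive. -/
lemma two_mul_empRisk_midpoint_lt (G : Matrix (Fin p) (Fin p) ℝ) {A B : Matrix (Fin p) (Fin p) ℝ}
    (hA : A.PosDef) (hB : B.PosDef) (hAB : A ≠ B) :
    2 * empRisk G ((1 / 2 : ℝ) • (A + B)) < empRisk G A + empRisk G B := by
  have hC : ((1 / 2 : ℝ) • (A + B)).PosDef := (hA.add hB).smul (by norm_num)
  set C := (1 / 2 : ℝ) • (A + B) with hCdef
  obtain ⟨S, hS, hSC⟩ := exists_transpose_mul_self_eq hC.inv
  have hCS : (Sᵀ * S)⁻¹ = C := by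
    rw [← hSC, Matrix.nonsing_inv_nonsing_inv _ ((Matrix.isUnit_iff_isUnit_det C).1 hC.isUnit)]
  have rem_nonneg : ∀ D : Matrix (Fin p) (Fin p) ℝ, D.PosDef → D ≠ C →
      0 < (S * D * Sᵀ - 1).trace - Real.log (S * D * Sᵀ).det := by
    intro D hD hDC
    refine lt_of_lt_of_le ?_ (le_trace_sub_log_det ((posDef_whiten_iff hS).2 hD))
    have h0 := frobNorm_nonneg (S * D * Sᵀ - 1)
    have h1 : frobNorm (S * D * Sᵀ - 1) ≠ 0 := by
      intro h
      have h2 := eq_zero_of_frobNorm_eq_zero h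
      rw [← whiten_sub hS] at h2
      have h3 := unwhiten hS (D - (Sᵀ * S)⁻¹)
      rw [h2, hCS] at h3
      simp only [mul_zero, zero_mul] at h3
      exact hDC (sub_eq_zero.1 h3.symm)
    positivity
  have hAC : A ≠ C := by
    intro h
    apply hAB
    have : (2 : ℝ) • A = A + B := by rw [h, hCdef, smul_smul]; norm_num [← hCdef, ← h]
    rw [two_smul] at this
    exact add_left_cancel this
  have hBC : B ≠ C := by
    intro h
    apply hAB
    have : (2 : ℝ) • B = A + B := by rw [h, hCdef, smul_smul]; norm_num [← hCdef, ← h]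
    rw [two_smul] at this
    exact (add_right_cancel this).symm
  have eA := empRisk_sub_empRisk_inv hS G hA
  have eB := empRisk_sub_empRisk_inv hS G hB
  rw [hCS] at eA eB
  have hz : ((A - C) * (G - Sᵀ * S)).trace + ((B - C) * (G - Sᵀ * S)).trace = 0 := by
    rw [← Matrix.trace_add, ← add_mul]
    have : A - C + (B - C) = 0 := by
      rw [hCdef]
      ext i j
      simp
      ring
    rw [this, zero_mul, Matrix.trace_zero]
  linarith [rem_nonneg A hA hAC, rem_nonneg B hB hBC]

lemma IsMLE.unique {E : SimpleGraph (Fin p)} {G A B : Matrix (Fin p) (Fin p) ℝ}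
    (hA : IsMLE E G A) (hB : IsMLE E G B) : A = B := by
  by_contra hAB
  have hC : (1 / 2 : ℝ) • (A + B) ∈ feasible E := by
    refine ⟨(hA.1.1.add hB.1.1).smul (by norm_num), fun i j hij hE => ?_⟩
    simp [hA.1.2 i j hij hE, hB.1.2 i j hij hE]
  have h := two_mul_empRisk_midpoint_lt G hA.1.1 hB.1.1 hAB
  have h1 := isMinOn_iff.1 hA.2 _ hC
  have h2 := isMinOn_iff.1 hB.2 _ hC
  linarith

/-! ### Existence and rate of the constrained minimizer -/

/-- The scalar core of the rate, used with ρ = U r. The constants 240 and 13 keep the right side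
small enough to exclude T ≥ 1/2. -/
lemma lt_half_and_le_of_sq_div_le {T V ρ : ℝ} (hT : 0 ≤ T) (hV : 0 ≤ V) (hρ : 0 ≤ ρ)
    (hρs : ρ * (240 + 13 * V) ≤ 1)
    (h : T ^ 2 / (2 * (1 + T)) ≤ 16 * ρ * T + 16 * ρ ^ 2 + (V * ρ) ^ 2) :
    T < 1 / 2 ∧ T ≤ (55 + 2 * V) * ρ := by
  have hVρ : 0 ≤ V * ρ := mul_nonneg hV hρ
  have h1 : ρ ≤ 1 / 240 := by nlinarith
  have h2 : V * ρ ≤ 1 / 13 := by nlinarith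
  have hT2 : T < 1 / 2 := by
    by_contra hge
    push Not at hge
    -- T/(2(1+T)) is increasing and equals 1/6 at T = 1/2.
    have h3 : T / 6 ≤ T ^ 2 / (2 * (1 + T)) := by
      rw [div_le_div_iff₀ (by norm_num) (by positivity)]
      nlinarith
    have h4 : 16 * ρ * T ≤ T / 15 := by nlinarith
    have h5 : ρ ^ 2 ≤ (1 / 240) ^ 2 := pow_le_pow_left₀ hρ h1 2
    have h6 : (V * ρ) ^ 2 ≤ (1 / 13) ^ 2 := pow_le_pow_left₀ hVρ h2 2
    linarith
  refine ⟨hT2, ?_⟩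
  have h3 : T ^ 2 / 3 ≤ T ^ 2 / (2 * (1 + T)) :=
    div_le_div_of_nonneg_left (sq_nonneg T) (by positivity) (by linarith)
  by_contra hlt
  push Not at hlt
  -- Clearing the 3 gives T(T - 48ρ) ≤ 48ρ² + 3(Vρ)², while T > (55 + 2V)ρ would make the left side
  -- exceed this.
  have h4 : (7 * ρ + 2 * (V * ρ)) ≤ T - 48 * ρ := by linarith
  have h5 : T * (7 * ρ + 2 * (V * ρ)) ≤ T * (T - 48 * ρ) := mul_le_mul_of_nonneg_left h4 hT
  rcases hρ.eq_or_lt with h0 | h0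
  · subst h0
    simp only [mul_zero, zero_mul] at hlt h h3
    nlinarith
  · have h6 : ((55 + 2 * V) * ρ) * (7 * ρ + 2 * (V * ρ)) < T * (7 * ρ + 2 * (V * ρ)) :=
      mul_lt_mul_of_pos_right hlt (by positivity)
    nlinarith [mul_nonneg hVρ hρ, mul_nonneg hVρ hVρ, mul_pos h0 h0]

lemma exists_isMLE_of_sublevel {E : SimpleGraph (Fin p)} {G S A₀ : Matrix (Fin p) (Fin p) ℝ}
    (hS : IsUnit S) {U : ℝ} (hU0 : 0 ≤ U)
    (hU : ∀ x : Fin p → ℝ, x ⬝ᵥ x ≤ U * (x ⬝ᵥ ((Sᵀ * S) *ᵥ x))) (hA₀ : A₀ ∈ feasible E)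
    (hsub : ∀ A ∈ feasible E, empRisk G A ≤ empRisk G A₀ →
      frobNorm (S * A * Sᵀ - 1) < 1 / 2) :
    ∃ A, IsMLE E G A := by
  -- Only symmetry is demanded, keeping `K` closed; positive definiteness is automatic since 1/2 <
  -- 1.
  let K : Set (Matrix (Fin p) (Fin p) ℝ) :=
    {A | Aᵀ = A ∧ (∀ i j, i ≠ j → ¬ E.Adj i j → A i j = 0) ∧ frobNorm (S * A * Sᵀ - 1) ≤ 1 / 2}
  have hKf : ∀ A ∈ K, A ∈ feasible E := by
    rintro A ⟨h1, h2, h3⟩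
    refine ⟨(posDef_whiten_iff hS).1 (posDef_of_frobNorm_sub_one_lt ?_ (by linarith)), h2⟩
    rw [Matrix.IsHermitian, Matrix.conjTranspose_eq_transpose_of_trivial, Matrix.transpose_mul,
      Matrix.transpose_mul, Matrix.transpose_transpose, h1, mul_assoc]
  have hclosed : IsClosed K := by
    have hc1 : IsClosed {A : Matrix (Fin p) (Fin p) ℝ | Aᵀ = A} :=
      isClosed_eq continuous_id.matrix_transpose continuous_id
    have hc2 : IsClosed {A : Matrix (Fin p) (Fin p) ℝ |
        ∀ i j, i ≠ j → ¬ E.Adj i j → A i j = 0} := by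
      simp only [Set.ofPred_forall]
      exact isClosed_iInter fun i => isClosed_iInter fun j => isClosed_iInter fun _ =>
        isClosed_iInter fun _ => isClosed_eq (continuous_id.matrix_elem i j) continuous_const
    have hc3 : IsClosed {A : Matrix (Fin p) (Fin p) ℝ |
        frobNorm (S * A * Sᵀ - 1) ≤ 1 / 2} := by
      refine isClosed_le ?_ continuous_const
      have hcont : Continuous fun A : Matrix (Fin p) (Fin p) ℝ => S * A * Sᵀ - 1 :=
        ((continuous_const.matrix_mul continuous_id).matrix_mul continuous_const).sub
          continuous_const
      unfold frobNorm
      exact Real.continuous_sqrt.comp (continuous_finsetSum _ fun i _ =>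
        continuous_finsetSum _ fun j _ => (hcont.matrix_elem i j).pow 2)
    exact hc1.inter (hc2.inter hc3)
  have hbd : ∀ A ∈ K, ∀ i j, |A i j - (Sᵀ * S)⁻¹ i j| ≤ U * (1 / 2) := by
    rintro A ⟨-, -, h3⟩ i j
    rw [← whiten_sub hS] at h3
    exact (abs_apply_le_frobNorm (A - (Sᵀ * S)⁻¹) i j).trans
      ((frobNorm_le_whiten hS hU0 hU _).trans (mul_le_mul_of_nonneg_left h3 hU0))
  have hcompact : IsCompact K := by
    have hbox : IsCompact (Set.univ.pi fun i => Set.univ.pi fun j =>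
        Set.Icc ((Sᵀ * S)⁻¹ i j - U * (1 / 2)) ((Sᵀ * S)⁻¹ i j + U * (1 / 2)) :
        Set (Matrix (Fin p) (Fin p) ℝ)) :=
      isCompact_univ_pi fun i => isCompact_univ_pi fun j => isCompact_Icc
    refine hbox.of_isClosed_subset hclosed ?_
    intro A hA i _ j _
    have h4 := abs_le.1 (hbd A hA i j)
    exact ⟨by linarith [h4.1], by linarith [h4.2]⟩
  have hA₀K : A₀ ∈ K := by
    refine ⟨?_, hA₀.2, (hsub A₀ hA₀ le_rfl).le⟩
    have := hA₀.1.1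
    rwa [Matrix.IsHermitian, Matrix.conjTranspose_eq_transpose_of_trivial] at this
  have hcont : ContinuousOn (empRisk G) K := by
    unfold empRisk
    refine ContinuousOn.sub (Continuous.continuousOn ?_) (ContinuousOn.log
      (Continuous.continuousOn ?_) fun A hA => (hKf A hA).1.det_pos.ne')
    · exact (continuous_id.matrix_mul continuous_const).matrix_trace
    · exact continuous_id.matrix_det
  obtain ⟨A, hAK, hA⟩ := hcompact.exists_isMinOn ⟨A₀, hA₀K⟩ hcont
  refine ⟨A, hKf A hAK, isMinOn_iff.2 fun B hB => ?_⟩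
  by_cases hle : empRisk G B ≤ empRisk G A₀
  · refine isMinOn_iff.1 hA B ⟨?_, hB.2, (hsub B hB hle).le⟩
    have := hB.1.1
    rwa [Matrix.IsHermitian, Matrix.conjTranspose_eq_transpose_of_trivial] at this
  · exact (isMinOn_iff.1 hA A₀ hA₀K).trans (not_le.1 hle).le

/-- Deterministic rate of the constrained maximum likelihood estimator around `Q⁻¹`. -/
theorem exists_isMLE_frobNorm_le {Q G A₀ : Matrix (Fin p) (Fin p) ℝ} (hQ : Q.PosDef)
    (E : SimpleGraph (Fin p)) {U V r s : ℝ} (hU1 : 1 ≤ U) (hV0 : 0 ≤ V) (hr0 : 0 ≤ r)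
    (hsU : s ≤ U)
    (hU : ∀ x : Fin p → ℝ, x ⬝ᵥ x ≤ U * (x ⬝ᵥ (Q *ᵥ x)))
    (hV : ∀ x : Fin p → ℝ, x ⬝ᵥ (Q *ᵥ x) ≤ V * (x ⬝ᵥ x))
    (hr : U * r * (240 + 13 * V) ≤ 1)
    (hA₀ : A₀.IsHermitian) (hA₀E : ∀ i j, i ≠ j → ¬ E.Adj i j → A₀ i j = 0)
    (hB : frobNorm (A₀ - Q⁻¹) ≤ s * r)
    (hG : ∀ D : Matrix (Fin p) (Fin p) ℝ, (∀ i j, i ≠ j → ¬ E.Adj i j → D i j = 0) →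
      |(D * (G - Q)).trace| ≤ 16 * r * frobNorm D) :
    ∃ A, IsMLE E G A ∧ (∀ A', IsMLE E G A' → A' = A) ∧
      frobNorm (A - Q⁻¹) ≤ (55 + 2 * V) * U ^ 2 * r := by
  obtain ⟨S, hS, rfl⟩ := exists_transpose_mul_self_eq hQ
  have hU0 : 0 ≤ U := by linarith
  have hUr : 0 ≤ U * r := mul_nonneg hU0 hr0
  have hsr : s * r ≤ U * r := mul_le_mul_of_nonneg_right hsU hr0
  have hT₀ : frobNorm (S * A₀ * Sᵀ - 1) ≤ V * (U * r) := by
    rw [← whiten_sub hS]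
    exact (frobNorm_whiten_le hV0 hV _).trans
      (mul_le_mul_of_nonneg_left (hB.trans hsr) hV0)
  have hT₀' : frobNorm (S * A₀ * Sᵀ - 1) ≤ 1 / 2 := by nlinarith
  have hA₀pd : A₀.PosDef := by
    refine (posDef_whiten_iff hS).1 (posDef_of_frobNorm_sub_one_lt ?_ (by linarith))
    have := Matrix.isHermitian_mul_mul_conjTranspose S hA₀
    rwa [Matrix.conjTranspose_eq_transpose_of_trivial] at this
  have key : ∀ A ∈ feasible E, empRisk G A ≤ empRisk G A₀ →
      frobNorm (S * A * Sᵀ - 1) < 1 / 2 ∧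
      frobNorm (S * A * Sᵀ - 1) ≤ (55 + 2 * V) * (U * r) := by
    intro A hA hle
    have e1 := empRisk_sub_empRisk_inv hS G hA.1
    have e2 := empRisk_sub_empRisk_inv hS G hA₀pd
    have l1 := le_trace_sub_log_det ((posDef_whiten_iff hS).2 hA.1)
    have l2 := trace_sub_log_det_le ((posDef_whiten_iff hS).2 hA₀pd) hT₀'
    have hT := frobNorm_le_whiten hS hU0 hU (A - (Sᵀ * S)⁻¹)
    rw [whiten_sub hS] at hT
    have hT0 := frobNorm_nonneg (S * A * Sᵀ - 1)
    have hD : frobNorm (A - A₀) ≤ U * frobNorm (S * A * Sᵀ - 1) + U * r := by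
      have h := frobNorm_sub_le (A - (Sᵀ * S)⁻¹) (A₀ - (Sᵀ * S)⁻¹)
      rw [sub_sub_sub_cancel_right] at h
      linarith
    have hlin := hG (A - A₀) fun i j hij hE => by
      simp [hA.2 i j hij hE, hA₀E i j hij hE]
    have hsplit : ((A - A₀) * (G - Sᵀ * S)).trace = ((A - (Sᵀ * S)⁻¹) * (G - Sᵀ * S)).trace
        - ((A₀ - (Sᵀ * S)⁻¹) * (G - Sᵀ * S)).trace := by
      rw [← Matrix.trace_sub, ← sub_mul, sub_sub_sub_cancel_right]
    have h16 : 16 * r * frobNorm (A - A₀) ≤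
        16 * r * (U * frobNorm (S * A * Sᵀ - 1) + U * r) :=
      mul_le_mul_of_nonneg_left hD (by linarith)
    -- U ≥ 1 lets every error be expressed through the single quantity U r.
    have hrr : U * r * r ≤ (U * r) ^ 2 := by
      rw [sq]
      exact mul_le_mul_of_nonneg_left (le_mul_of_one_le_left hr0 hU1) hUr
    have hsq := pow_le_pow_left₀ (frobNorm_nonneg _) hT₀ 2
    refine lt_half_and_le_of_sq_div_le hT0 hV0 hUr hr ?_
    have := (abs_le.1 hlin).1
    nlinarith
  obtain ⟨A, hA⟩ := exists_isMLE_of_sublevel hS hU0 hU ⟨hA₀pd, hA₀E⟩ fun A h1 h2 => (key A h1 h2).1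
  refine ⟨A, hA, fun A' hA' => hA'.unique hA, ?_⟩
  have h1 := (key A hA.1 (isMinOn_iff.1 hA.2 _ ⟨hA₀pd, hA₀E⟩)).2
  have h2 := frobNorm_le_whiten hS hU0 hU (A - (Sᵀ * S)⁻¹)
  rw [whiten_sub hS] at h2
  calc _ ≤ U * frobNorm (S * A * Sᵀ - 1) := h2
    _ ≤ U * ((55 + 2 * V) * (U * r)) := mul_le_mul_of_nonneg_left h1 hU0
    _ = _ := by ring

end GaussGraph

namespace GaussGraph

variable {p : ℕ}

/-! ### Concentration of Gaussian quadratic averages -/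

open scoped NNReal

variable {Ω : Type*} [MeasurableSpace Ω] {P : Measure Ω}

lemma integral_exp_mul_sq_gaussianReal {v : ℝ≥0} (hv : v ≠ 0) {s : ℝ} (hs : 2 * (s * v) < 1) :
    ∫ x, Real.exp (s * x ^ 2) ∂(gaussianReal 0 v) = (√(1 - 2 * (s * v)))⁻¹ := by
  have hv0 : (0 : ℝ) < v := by positivity
  have hπ := Real.pi_pos
  have hb : 0 < 1 - 2 * (s * v) := by linarith
  rw [integral_gaussianReal_eq_integral_smul hv]
  have h : ∀ x : ℝ, gaussianPDFReal 0 v x • Real.exp (s * x ^ 2) =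
      (√(2 * Real.pi * v))⁻¹ * Real.exp (-((1 - 2 * (s * v)) / (2 * v)) * x ^ 2) := by
    intro x
    rw [gaussianPDFReal, smul_eq_mul, mul_assoc, ← Real.exp_add]
    congr 2
    field_simp
    ring
  simp only [h]
  rw [integral_const_mul, integral_gaussian, ← Real.sqrt_inv, ← Real.sqrt_inv, ← Real.sqrt_mul
    (by positivity)]
  congr 1
  field_simp

/-- The threshold 1/4 is y ≥ -1/2 in the quadratic logarithm bound at y = -2x. -/
lemma inv_sqrt_le_exp {x : ℝ} (hx : x ≤ 1 / 4) :
    (√(1 - 2 * x))⁻¹ ≤ Real.exp (x + 2 * x ^ 2) := by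
  have hb : 0 < 1 - 2 * x := by linarith
  have h := sub_log_one_add_le_sq (y := -(2 * x)) (by linarith)
  have h1 : 1 + -(2 * x) = 1 - 2 * x := by ring
  rw [h1] at h
  rw [← Real.log_le_iff_le_exp (by positivity), Real.log_inv, Real.log_sqrt hb.le]
  linarith

lemma mgf_sq_le {Z : Ω → ℝ} {v : ℝ≥0} (hv : v ≠ 0) (hZ : HasLaw Z (gaussianReal 0 v) P) {s : ℝ}
    (hs : s * v ≤ 1 / 4) :
    mgf (fun ω => Z ω ^ 2) P s ≤ Real.exp (s * v + 2 * (s * v) ^ 2) ∧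
      Integrable (fun ω => Real.exp (s * Z ω ^ 2)) P := by
  have h : ∫ ω, Real.exp (s * Z ω ^ 2) ∂P = (√(1 - 2 * (s * v)))⁻¹ := by
    rw [← integral_exp_mul_sq_gaussianReal hv (by linarith)]
    exact hZ.integral_comp (f := fun x => Real.exp (s * x ^ 2))
      (Measurable.aestronglyMeasurable (by fun_prop))
  refine ⟨h.trans_le (inv_sqrt_le_exp hs), ?_⟩
  -- A non-integrable function has Bochner integral 0, contradicting the positive closed form.
  by_contra hint
  rw [integral_undef hint] at h
  have : 0 < (√(1 - 2 * (s * v)))⁻¹ := inv_pos.2 (Real.sqrt_pos.2 (by linarith))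
  linarith

/-- Two-sided tail bound for a scaled chi-square variable. -/
lemma measureReal_abs_sum_sq_sub_gt_le [IsProbabilityMeasure P] {n : ℕ} {Z : Fin n → Ω → ℝ}
    {v : ℝ≥0} (hZ : ∀ r, HasLaw (Z r) (gaussianReal 0 v) P) (hind : iIndepFun Z P) {t : ℝ}
    (ht0 : 0 ≤ t) (ht1 : t ≤ 1) :
    P.real {ω | ¬ |∑ r, Z r ω ^ 2 - n * v| ≤ n * (t * v)} ≤ 2 * Real.exp (-(n * t ^ 2 / 8)) := by
  -- Zero variance does occur: it is the difference of a coordinate with itself.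
  rcases eq_or_ne v 0 with rfl | hv
  · have h : ∀ᵐ ω ∂P, ∀ r, Z r ω = 0 := ae_all_iff.2 fun r => by
      have := hZ r
      rw [gaussianReal_zero_var] at this
      exact this.ae_eq_of_dirac
    have h0 : P.real {ω | ¬ |∑ r, Z r ω ^ 2 - n * ((0 : ℝ≥0) : ℝ)| ≤
        n * (t * ((0 : ℝ≥0) : ℝ))} = 0 := by
      rw [measureReal_def, measure_eq_zero_iff_ae_notMem.2, ENNReal.toReal_zero]
      filter_upwards [h] with ω hω
      simp [hω]
    rw [h0]
    positivity
  have hv0 : (0 : ℝ) < v := by positivity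
  have hind2 : iIndepFun (fun r ω => Z r ω ^ 2) P :=
    hind.comp (fun _ x => x ^ 2) fun _ => by fun_prop
  have hmeas : ∀ r, AEMeasurable (fun ω => Z r ω ^ 2) P := fun r =>
    (hZ r).aemeasurable.pow_const 2
  have hmgf : ∀ s : ℝ, s * v ≤ 1 / 4 →
      mgf (∑ r, fun ω => Z r ω ^ 2) P s ≤ Real.exp (n * (s * v + 2 * (s * v) ^ 2)) := by
    intro s hs
    rw [hind2.mgf_sum₀ hmeas]
    calc _ ≤ ∏ r : Fin n, Real.exp (s * v + 2 * (s * v) ^ 2) :=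
          Finset.prod_le_prod (fun _ _ => mgf_nonneg) fun r _ => (mgf_sq_le hv (hZ r) hs).1
      _ = _ := by rw [Finset.prod_const, Finset.card_fin, ← Real.exp_nat_mul]
  have hint : ∀ s : ℝ, s * v ≤ 1 / 4 →
      Integrable (fun ω => Real.exp (s * (∑ r, fun ω => Z r ω ^ 2) ω)) P := by
    intro s hs
    by_contra hni
    have h0 := hind2.mgf_sum₀ (t := s) hmeas Finset.univ
    rw [mgf_undef hni] at h0
    exact (Finset.prod_pos fun r _ => mgf_pos (mgf_sq_le hv (hZ r) hs).2).ne h0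
  have hup : P.real {ω | n * v + n * (t * v) ≤ (∑ r, fun ω => Z r ω ^ 2) ω} ≤
      Real.exp (-(n * t ^ 2 / 8)) := by
    -- The Chernoff parameter s = t/(4v) gives exponent -nt²/4 + nt²/8 = -nt²/8.
    have hs : t / (4 * v) * v = t / 4 := by field_simp
    have hs1 : t / (4 * v) * v ≤ 1 / 4 := by linarith
    refine (measure_ge_le_exp_mul_mgf _ (by positivity : 0 ≤ t / (4 * v)) (hint _ hs1)).trans ?_
    refine (mul_le_mul_of_nonneg_left (hmgf _ hs1) (Real.exp_pos _).le).trans_eq ?_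
    rw [← Real.exp_add, hs]
    congr 1
    field_simp
    ring
  have hlo : P.real {ω | (∑ r, fun ω => Z r ω ^ 2) ω ≤ n * v - n * (t * v)} ≤
      Real.exp (-(n * t ^ 2 / 8)) := by
    have hs : -(t / (4 * v)) * v = -(t / 4) := by field_simp
    have hs1 : -(t / (4 * v)) * v ≤ 1 / 4 := by linarith
    refine (measure_le_le_exp_mul_mgf _ (neg_nonpos.2 (by positivity) : -(t / (4 * v)) ≤ 0)
      (hint _ hs1)).trans ?_
    refine (mul_le_mul_of_nonneg_left (hmgf _ hs1) (Real.exp_pos _).le).trans_eq ?_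
    rw [← Real.exp_add, hs]
    congr 1
    field_simp
    ring
  refine (measureReal_mono (?_ : _ ⊆ {ω | n * v + n * (t * v) ≤ (∑ r, fun ω => Z r ω ^ 2) ω} ∪
    {ω | (∑ r, fun ω => Z r ω ^ 2) ω ≤ n * v - n * (t * v)})).trans
    ((measureReal_union_le _ _).trans (by linarith))
  intro ω hω
  simp only [Set.mem_ofPred_eq, abs_le, Set.mem_union, Finset.sum_apply] at hω ⊢
  by_contra hcon
  push Not at hcon
  exact hω ⟨by linarith [hcon.2], by linarith [hcon.1]⟩

lemma hasLaw_inner_multivariateGaussian {Y : Ω → EuclideanSpace ℝ (Fin p)}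
    {S : Matrix (Fin p) (Fin p) ℝ} (hS : S.PosSemidef) (hY : HasLaw Y (multivariateGaussian 0 S) P)
    (a : EuclideanSpace ℝ (Fin p)) :
    HasLaw (fun ω => inner ℝ a (Y ω)) (gaussianReal 0 (a ⬝ᵥ S *ᵥ a).toNNReal) P := by
  have h : HasLaw (innerSL ℝ a) (gaussianReal 0 (a ⬝ᵥ S *ᵥ a).toNNReal)
      (multivariateGaussian 0 S) := by
    refine ⟨by fun_prop, ?_⟩
    rw [IsGaussian.map_eq_gaussianReal, ContinuousLinearMap.integral_comp_id_comm
      IsGaussian.integrable_id, ← covarianceBilin_multivariateGaussian (μ := 0) hS,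
      covarianceBilin_self IsGaussian.memLp_two_id]
    simp
  exact h.comp hY

end GaussGraph

namespace GaussGraph

variable {p n : ℕ} {Ω : Type*} [MeasurableSpace Ω] {P : Measure Ω}

/-! ### Uniform concentration of the sample correlations -/

/-- The sign `1` or `-1`. -/
def boolSign (b : Bool) : ℝ := if b then 1 else -1

lemma boolSign_sq (b : Bool) : boolSign b ^ 2 = 1 := by cases b <;> norm_num [boolSign]

lemma corrMatrix_apply (S : Matrix (Fin p) (Fin p) ℝ) (i j : Fin p) :
    corrMatrix S i j = S i j / (√(S i i) * √(S j j)) := rfl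

lemma corrMatrix_self {S : Matrix (Fin p) (Fin p) ℝ} {i : Fin p} (h : 0 < S i i) :
    corrMatrix S i i = 1 := by
  rw [corrMatrix_apply, Real.mul_self_sqrt h.le, div_self h.ne']

lemma hasLaw_normalized_pair {Y : Ω → EuclideanSpace ℝ (Fin p)} {S : Matrix (Fin p) (Fin p) ℝ}
    (hS : S.PosDef) (hY : HasLaw Y (multivariateGaussian 0 S) P) (i j : Fin p) (b : Bool) :
    0 ≤ 2 + 2 * boolSign b * corrMatrix S i j ∧
    HasLaw (fun ω => Y ω i / √(S i i) + boolSign b * (Y ω j / √(S j j)))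
      (gaussianReal 0 (2 + 2 * boolSign b * corrMatrix S i j).toNNReal) P := by
  set c := (√(S i i))⁻¹ with hc
  set e := boolSign b * (√(S j j))⁻¹ with he
  set a : EuclideanSpace ℝ (Fin p) := WithLp.toLp 2 (Pi.single i c + Pi.single j e) with ha
  have hsym : S j i = S i j := by simpa using hS.1.apply i j
  have hii : c ^ 2 * S i i = 1 := by
    rw [hc, inv_pow, Real.sq_sqrt hS.diag_pos.le, inv_mul_cancel₀ hS.diag_pos.ne']
  have hjj : e ^ 2 * S j j = 1 := by
    rw [he, mul_pow, boolSign_sq, one_mul, inv_pow, Real.sq_sqrt hS.diag_pos.le,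
      inv_mul_cancel₀ hS.diag_pos.ne']
  have hquad : a.ofLp ⬝ᵥ S *ᵥ a.ofLp = 2 + 2 * boolSign b * corrMatrix S i j := by
    have : a.ofLp ⬝ᵥ S *ᵥ a.ofLp = c ^ 2 * S i i + e ^ 2 * S j j + 2 * (c * e * S i j) := by
      simp only [ha, Matrix.mulVec_add, add_dotProduct, dotProduct_add, single_dotProduct,
        Matrix.mulVec_single, Pi.smul_apply, Matrix.col_apply, MulOpposite.smul_eq_mul_unop,
        MulOpposite.unop_op, hsym]
      ring
    rw [this, hii, hjj, corrMatrix_apply, hc, he]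
    field_simp
    ring
  refine ⟨?_, ?_⟩
  · rw [← hquad]
    simpa using hS.posSemidef.dotProduct_mulVec_nonneg a.ofLp
  · have h := hasLaw_inner_multivariateGaussian hS.posSemidef hY a
    rw [hquad] at h
    convert h using 2 with ω
    simp only [ha, PiLp.inner_apply, RCLike.inner_apply, conj_trivial, Pi.add_apply, mul_add,
      Finset.sum_add_distrib, Pi.single_apply, mul_ite, mul_zero, Finset.sum_ite_eq',
      Finset.mem_univ, if_true]
    rw [hc, he]
    ring

/-- The normalized sums and differences of coordinates have empirical second moments within a
relative error `t` of their variances. -/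
def PairsConcentrated (S : Matrix (Fin p) (Fin p) ℝ) (t : ℝ)
    (x : Fin n → EuclideanSpace ℝ (Fin p)) : Prop :=
  ∀ (i j : Fin p) (b : Bool),
    |∑ r, (x r i / √(S i i) + boolSign b * (x r j / √(S j j))) ^ 2 -
      n * (2 + 2 * boolSign b * corrMatrix S i j)| ≤
      n * (t * (2 + 2 * boolSign b * corrMatrix S i j))

lemma measureReal_not_pairsConcentrated_le [IsProbabilityMeasure P]
    {X : Fin n → Ω → EuclideanSpace ℝ (Fin p)} {S : Matrix (Fin p) (Fin p) ℝ} (hS : S.PosDef)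
    (hX : ∀ r, HasLaw (X r) (multivariateGaussian 0 S) P) (hind : iIndepFun X P) {t : ℝ}
    (ht0 : 0 ≤ t) (ht1 : t ≤ 1) :
    P.real {ω | ¬ PairsConcentrated S t fun r => X r ω} ≤
      4 * (p : ℝ) ^ 2 * Real.exp (-(n * t ^ 2 / 8)) := by
  let B : Fin p × Fin p × Bool → Set Ω := fun q =>
    {ω | ¬ |∑ r, (X r ω q.1 / √(S q.1 q.1) + boolSign q.2.2 * (X r ω q.2.1 / √(S q.2.1 q.2.1))) ^ 2
      - n * (2 + 2 * boolSign q.2.2 * corrMatrix S q.1 q.2.1)| ≤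
      n * (t * (2 + 2 * boolSign q.2.2 * corrMatrix S q.1 q.2.1))}
  have hsub : {ω | ¬ PairsConcentrated S t fun r => X r ω} ⊆ ⋃ q, B q := by
    intro ω hω
    simp only [Set.mem_ofPred_eq, PairsConcentrated] at hω
    push Not at hω
    obtain ⟨i, j, b, h⟩ := hω
    exact Set.mem_iUnion.2 ⟨(i, j, b), not_le.2 h⟩
  have hB : ∀ q, P.real (B q) ≤ 2 * Real.exp (-(n * t ^ 2 / 8)) := by
    rintro ⟨i, j, b⟩
    rcases isEmpty_or_nonempty (Fin n) with hn | ⟨⟨r₀⟩⟩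
    · have : n = 0 := by
        by_contra h
        exact hn.elim ⟨0, Nat.pos_of_ne_zero h⟩
      subst this
      simp [B]
    have hv := (hasLaw_normalized_pair hS (hX r₀) i j b).1
    have h := measureReal_abs_sum_sq_sub_gt_le
      (fun r => (hasLaw_normalized_pair hS (hX r) i j b).2)
      (hind.comp (fun _ y => y i / √(S i i) + boolSign b * (y j / √(S j j)))
        fun _ => by fun_prop) ht0 ht1
    rwa [Real.coe_toNNReal _ hv] at h
  calc _ ≤ P.real (⋃ q, B q) := measureReal_mono hsub
    _ ≤ ∑ q, P.real (B q) := measureReal_iUnion_fintype_le _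
    _ ≤ ∑ _q : Fin p × Fin p × Bool, 2 * Real.exp (-(n * t ^ 2 / 8)) :=
        Finset.sum_le_sum fun q _ => hB q
    _ = _ := by
        simp
        ring

/-- Polarization: the errors for sum and difference are nt(2 + 2ψ) and nt(2 - 2ψ), with total 4nt
whatever the correlation ψ. -/
lemma PairsConcentrated.abs_sum_mul_sub_le {S : Matrix (Fin p) (Fin p) ℝ} {t : ℝ}
    {x : Fin n → EuclideanSpace ℝ (Fin p)} (h : PairsConcentrated S t x) (i j : Fin p) :
    |∑ r, (x r i / √(S i i)) * (x r j / √(S j j)) - n * corrMatrix S i j| ≤ n * t := by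
  have h1 := abs_le.1 (h i j true)
  have h2 := abs_le.1 (h i j false)
  have e : ∀ s : ℝ, ∑ r, (x r i / √(S i i) + s * (x r j / √(S j j))) ^ 2 =
      ∑ r, (x r i / √(S i i)) ^ 2 + s ^ 2 * ∑ r, (x r j / √(S j j)) ^ 2 +
        2 * s * ∑ r, (x r i / √(S i i)) * (x r j / √(S j j)) := by
    intro s
    simp only [Finset.mul_sum, ← Finset.sum_add_distrib]
    exact Finset.sum_congr rfl fun r _ => by ring
  simp only [e] at h1 h2
  simp only [boolSign, if_true, Bool.false_eq_true, if_false] at h1 h2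
  rw [abs_le]
  constructor <;> linarith [h1.1, h1.2, h2.1, h2.2]

lemma sqrt_mul_sqrt_mem_Icc {a b t : ℝ} (ht : t ≤ 1) (ha : |a - 1| ≤ t) (hb : |b - 1| ≤ t) :
    1 - t ≤ √a * √b ∧ √a * √b ≤ 1 + t := by
  rw [abs_le] at ha hb
  have ht0 : 0 ≤ t := by linarith
  rw [← Real.sqrt_mul (by linarith)]
  constructor
  · exact Real.le_sqrt_of_sq_le (by nlinarith)
  · exact Real.sqrt_le_iff.2 ⟨by linarith, by nlinarith⟩

/-- Numerator and normalization each cost t, and the denominator is at least 7/8. -/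
lemma abs_div_sub_le {a b m ψ t : ℝ} (ht : t ≤ 1 / 8) (ha : |a - 1| ≤ t) (hb : |b - 1| ≤ t)
    (hm : |m - ψ| ≤ t) (hψ : |ψ| ≤ 1) : |m / (√a * √b) - ψ| ≤ 16 / 7 * t := by
  obtain ⟨h1, h2⟩ := sqrt_mul_sqrt_mem_Icc (by linarith) ha hb
  set q := √a * √b
  have hq : 0 < q := by linarith
  have hq1 : |1 - q| ≤ t := abs_le.2 ⟨by linarith, by linarith⟩
  have ht0 : 0 ≤ t := (abs_nonneg _).trans ha
  have e : m / q - ψ = (m - ψ + ψ * (1 - q)) / q := by field_simp; ring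
  rw [e, abs_div, abs_of_pos hq, div_le_iff₀ hq]
  calc |m - ψ + ψ * (1 - q)| ≤ |m - ψ| + |ψ * (1 - q)| := abs_add_le _ _
    _ ≤ t + 1 * t := by
      rw [abs_mul]
      exact add_le_add hm (mul_le_mul hψ hq1 (abs_nonneg _) zero_le_one)
    _ ≤ 16 / 7 * t * q := by nlinarith

lemma sum_normalized_eq {S : Matrix (Fin p) (Fin p) ℝ} (hn : 0 < n)
    (x : Fin n → EuclideanSpace ℝ (Fin p)) (i j : Fin p) :
    ∑ r, (x r i / √(S i i)) * (x r j / √(S j j)) =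
      n * (sampleCov x i j / (√(S i i) * √(S j j))) := by
  have hn' : (n : ℝ) ≠ 0 := by positivity
  rw [sampleCov, Matrix.of_apply, mul_div_assoc', mul_div_cancel₀ _ hn', Finset.sum_div]
  exact Finset.sum_congr rfl fun r _ => div_mul_div_comm _ _ _ _

lemma PairsConcentrated.corrMatrix_sampleCov {S : Matrix (Fin p) (Fin p) ℝ} (hS : S.PosDef)
    {t : ℝ} {x : Fin n → EuclideanSpace ℝ (Fin p)} (h : PairsConcentrated S t x) (hn : 0 < n)
    (ht : t ≤ 1 / 8) (hψ : ∀ i j, |corrMatrix S i j| ≤ 1) :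
    (∀ i, 0 < sampleCov x i i) ∧
      ∀ i j, |corrMatrix (sampleCov x) i j - corrMatrix S i j| ≤ 16 / 7 * t := by
  have hn' : (0 : ℝ) < n := by positivity
  have hd : ∀ i, 0 < √(S i i) := fun i => Real.sqrt_pos.2 hS.diag_pos
  have hm : ∀ i j, |sampleCov x i j / (√(S i i) * √(S j j)) - corrMatrix S i j| ≤ t := by
    intro i j
    have h1 := h.abs_sum_mul_sub_le i j
    rw [sum_normalized_eq hn, ← mul_sub, abs_mul, abs_of_pos hn'] at h1
    exact le_of_mul_le_mul_left h1 hn'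
  have hm1 : ∀ i, |sampleCov x i i / S i i - 1| ≤ t := by
    intro i
    have h1 := hm i i
    rwa [corrMatrix_self hS.diag_pos, Real.mul_self_sqrt hS.diag_pos.le] at h1
  refine ⟨fun i => ?_, fun i j => ?_⟩
  · have h1 := (abs_le.1 (hm1 i)).1
    by_contra hneg
    have : sampleCov x i i / S i i ≤ 0 := div_nonpos_of_nonpos_of_nonneg (not_lt.1 hneg)
      hS.diag_pos.le
    linarith
  · have h1 := abs_div_sub_le ht (hm1 i) (hm1 j) (hm i j) (hψ i j)
    -- Correlations are invariant under rescaling, so the sample may be taken with unit population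
    -- variances.
    have e : corrMatrix (sampleCov x) i j = sampleCov x i j / (√(S i i) * √(S j j)) /
        (√(sampleCov x i i / S i i) * √(sampleCov x j j / S j j)) := by
      rw [corrMatrix_apply, Real.sqrt_div' _ hS.diag_pos.le, Real.sqrt_div' _ hS.diag_pos.le,
        div_mul_div_comm, div_div_div_cancel_right₀ (mul_pos (hd i) (hd j)).ne']
    rwa [e]

end GaussGraph

namespace GaussGraph

variable {p n : ℕ}

/-! ### Spectral bounds for the covariance and the correlation matrix -/

lemma dotProduct_mulVec_bounds {S : Matrix (Fin p) (Fin p) ℝ} (h : S.IsHermitian) {a b : ℝ}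
    (hab : ∀ i, a ≤ h.eigenvalues i ∧ h.eigenvalues i ≤ b) (x : Fin p → ℝ) :
    a * (x ⬝ᵥ x) ≤ x ⬝ᵥ (S *ᵥ x) ∧ x ⬝ᵥ (S *ᵥ x) ≤ b * (x ⬝ᵥ x) := by
  obtain ⟨W, hW, hS⟩ : ∃ W : Matrix (Fin p) (Fin p) ℝ, Wᵀ * W = 1 ∧
      S = Wᵀ * Matrix.diagonal h.eigenvalues * W := by
    refine ⟨star (h.eigenvectorUnitary : Matrix (Fin p) (Fin p) ℝ), ?_, ?_⟩
    · rw [Matrix.star_eq_conjTranspose, Matrix.conjTranspose_eq_transpose_of_trivial,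
        Matrix.transpose_transpose]
      have := Unitary.coe_mul_star_self h.eigenvectorUnitary
      rwa [Unitary.coe_star, Matrix.star_eq_conjTranspose,
        Matrix.conjTranspose_eq_transpose_of_trivial] at this
    · conv_lhs => rw [h.spectral_theorem, Unitary.conjStarAlgAut_apply]
      rw [Matrix.star_eq_conjTranspose, Matrix.conjTranspose_eq_transpose_of_trivial,
        Matrix.transpose_transpose]
      rfl
  have hq : x ⬝ᵥ (S *ᵥ x) = ∑ i, h.eigenvalues i * (W *ᵥ x) i ^ 2 := by
    conv_lhs => rw [hS]
    rw [← Matrix.mulVec_mulVec, ← Matrix.mulVec_mulVec, Matrix.dotProduct_mulVec x,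
      Matrix.vecMul_transpose]
    simp only [dotProduct, Matrix.mulVec_diagonal]
    exact Finset.sum_congr rfl fun i _ => by ring
  have hx : x ⬝ᵥ x = ∑ i, (W *ᵥ x) i ^ 2 := by
    have := dotProduct_mulVec_self W x
    rw [hW, Matrix.one_mulVec] at this
    rw [← this]
    simp only [dotProduct, sq]
  rw [hq, hx, Finset.mul_sum, Finset.mul_sum]
  exact ⟨Finset.sum_le_sum fun i _ => mul_le_mul_of_nonneg_right (hab i).1 (sq_nonneg _),
    Finset.sum_le_sum fun i _ => mul_le_mul_of_nonneg_right (hab i).2 (sq_nonneg _)⟩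

lemma le_maxVar (S : Matrix (Fin p) (Fin p) ℝ) (i : Fin p) : S i i ≤ maxVar S :=
  le_ciSup (f := fun i => S i i) (Set.finite_range _).bddAbove i

lemma minVar_le (S : Matrix (Fin p) (Fin p) ℝ) (i : Fin p) : minVar S ≤ S i i :=
  ciInf_le (f := fun i => S i i) (Set.finite_range _).bddBelow i

lemma minVar_pos {S : Matrix (Fin p) (Fin p) ℝ} (hS : S.PosDef) (hp : 0 < p) : 0 < minVar S := by
  have : Nonempty (Fin p) := ⟨⟨0, hp⟩⟩
  obtain ⟨i, hi⟩ := exists_eq_ciInf_of_finite (f := fun i => S i i)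
  rw [minVar, ← hi]
  exact hS.diag_pos

/-- The diagonal matrix of standard deviations. -/
noncomputable def sdMatrix (S : Matrix (Fin p) (Fin p) ℝ) : Matrix (Fin p) (Fin p) ℝ :=
  Matrix.diagonal fun i => √(S i i)

lemma sdMatrix_mul_mul_apply (S A : Matrix (Fin p) (Fin p) ℝ) (i j : Fin p) :
    (sdMatrix S * A * sdMatrix S) i j = √(S i i) * A i j * √(S j j) := by
  rw [sdMatrix, Matrix.mul_diagonal, Matrix.diagonal_mul]

lemma sdMatrix_mul_inv {S : Matrix (Fin p) (Fin p) ℝ} (hS : S.PosDef) :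
    sdMatrix S * Matrix.diagonal (fun i => (√(S i i))⁻¹) = 1 := by
  rw [sdMatrix, Matrix.diagonal_mul_diagonal, ← Matrix.diagonal_one]
  congr 1
  funext i
  exact mul_inv_cancel₀ (Real.sqrt_pos.2 hS.diag_pos).ne'

lemma corrMatrix_eq (S : Matrix (Fin p) (Fin p) ℝ) :
    corrMatrix S = Matrix.diagonal (fun i => (√(S i i))⁻¹) * S *
      Matrix.diagonal (fun i => (√(S i i))⁻¹) := by
  ext i j
  rw [corrMatrix_apply, Matrix.mul_diagonal, Matrix.diagonal_mul, div_eq_mul_inv, mul_inv]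
  ring

/-- Diagonal rescaling carries Θ₀ to Ω₀ and preserves zero patterns, so truncating Θ₀ also yields a
feasible comparison point for Ω₀. -/
lemma corrMatrix_inv {S : Matrix (Fin p) (Fin p) ℝ} (hS : S.PosDef) :
    (corrMatrix S)⁻¹ = sdMatrix S * S⁻¹ * sdMatrix S := by
  have h1 := sdMatrix_mul_inv hS
  have h2 : Matrix.diagonal (fun i => (√(S i i))⁻¹) * sdMatrix S = 1 := mul_eq_one_comm.1 h1
  have h3 : S * S⁻¹ = 1 :=
    Matrix.mul_nonsing_inv _ ((Matrix.isUnit_iff_isUnit_det S).1 hS.isUnit)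
  refine Matrix.inv_eq_right_inv ?_
  rw [corrMatrix_eq]
  set D := Matrix.diagonal (fun i => (√(S i i))⁻¹)
  calc D * S * D * (sdMatrix S * S⁻¹ * sdMatrix S)
      = D * S * (D * sdMatrix S) * S⁻¹ * sdMatrix S := by noncomm_ring
    _ = D * (S * S⁻¹) * sdMatrix S := by rw [h2]; noncomm_ring
    _ = 1 := by rw [h3, mul_one, h2]

lemma corrMatrix_quadratic (S : Matrix (Fin p) (Fin p) ℝ) (x : Fin p → ℝ) :
    x ⬝ᵥ (corrMatrix S *ᵥ x) =
      (fun i => (√(S i i))⁻¹ * x i) ⬝ᵥ (S *ᵥ fun i => (√(S i i))⁻¹ * x i) := by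
  have h : Matrix.diagonal (fun i => (√(S i i))⁻¹) *ᵥ x = fun i => (√(S i i))⁻¹ * x i := by
    funext i
    rw [Matrix.mulVec_diagonal]
  rw [corrMatrix_eq, ← Matrix.mulVec_mulVec, ← Matrix.mulVec_mulVec, h,
    Matrix.dotProduct_mulVec x]
  congr 1
  funext i
  rw [Matrix.vecMul_diagonal]
  ring

lemma corrMatrix_posDef {S : Matrix (Fin p) (Fin p) ℝ} (hS : S.PosDef) :
    (corrMatrix S).PosDef := by
  have hu : IsUnit (Matrix.diagonal fun i => (√(S i i))⁻¹) :=
    IsUnit.of_mul_eq_one_right _ (sdMatrix_mul_inv hS)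
  have h := (posDef_whiten_iff hu).2 hS
  rwa [Matrix.diagonal_transpose, ← corrMatrix_eq] at h

lemma dotProduct_self_le_corr {S : Matrix (Fin p) (Fin p) ℝ} (hS : S.PosDef) {a : ℝ} (ha : 0 < a)
    (h : ∀ x : Fin p → ℝ, a * (x ⬝ᵥ x) ≤ x ⬝ᵥ (S *ᵥ x)) (hm : 0 ≤ maxVar S) (x : Fin p → ℝ) :
    x ⬝ᵥ x ≤ maxVar S / a * (x ⬝ᵥ (corrMatrix S *ᵥ x)) := by
  rw [corrMatrix_quadratic]
  set y : Fin p → ℝ := fun i => (√(S i i))⁻¹ * x i with hy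
  have h1 : x ⬝ᵥ x ≤ maxVar S * (y ⬝ᵥ y) := by
    simp only [dotProduct, Finset.mul_sum]
    refine Finset.sum_le_sum fun i _ => ?_
    have hp : 0 < S i i := hS.diag_pos
    have : x i * x i = S i i * (y i * y i) := by
      have e : y i * y i = (√(S i i) ^ 2)⁻¹ * (x i * x i) := by
        simp only [hy]
        rw [sq, mul_inv]
        ring
      rw [e, Real.sq_sqrt hp.le, mul_inv_cancel_left₀ hp.ne']
    rw [this]
    exact mul_le_mul_of_nonneg_right (le_maxVar S i) (mul_self_nonneg _)
  calc x ⬝ᵥ x ≤ maxVar S * (y ⬝ᵥ y) := h1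
    _ = maxVar S / a * (a * (y ⬝ᵥ y)) := by field_simp
    _ ≤ _ := mul_le_mul_of_nonneg_left (h y) (by positivity)

lemma corr_le_dotProduct_self {S : Matrix (Fin p) (Fin p) ℝ} (hS : S.PosDef) {b : ℝ} (hb : 0 ≤ b)
    (h : ∀ x : Fin p → ℝ, x ⬝ᵥ (S *ᵥ x) ≤ b * (x ⬝ᵥ x)) (hm : 0 < minVar S) (x : Fin p → ℝ) :
    x ⬝ᵥ (corrMatrix S *ᵥ x) ≤ b / minVar S * (x ⬝ᵥ x) := by
  rw [corrMatrix_quadratic]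
  refine (h _).trans ?_
  rw [div_mul_eq_mul_div, mul_div_assoc]
  refine mul_le_mul_of_nonneg_left ?_ hb
  rw [le_div_iff₀ hm]
  simp only [dotProduct, Finset.sum_mul]
  refine Finset.sum_le_sum fun i _ => ?_
  have hp : 0 < S i i := hS.diag_pos
  have e : (√(S i i))⁻¹ * x i * ((√(S i i))⁻¹ * x i) = (S i i)⁻¹ * (x i * x i) := by
    rw [← Real.sq_sqrt hp.le, Real.sqrt_sq (Real.sqrt_nonneg _), sq, mul_inv]
    ring
  rw [e]
  calc (S i i)⁻¹ * (x i * x i) * minVar S ≤ (S i i)⁻¹ * (x i * x i) * S i i :=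
        mul_le_mul_of_nonneg_left (minVar_le S i)
          (mul_nonneg (inv_nonneg.2 hp.le) (mul_self_nonneg _))
    _ = x i * x i := by field_simp

lemma frobNorm_sdMatrix_le {S : Matrix (Fin p) (Fin p) ℝ} (hS : S.PosDef) (hm : 0 ≤ maxVar S)
    (A : Matrix (Fin p) (Fin p) ℝ) :
    frobNorm (sdMatrix S * A * sdMatrix S) ≤ maxVar S * frobNorm A := by
  have h := frobNorm_congr_le (N := sdMatrix S) hm (fun x => ?_) A
  · rwa [sdMatrix, Matrix.diagonal_transpose] at h
  · simp only [sdMatrix, dotProduct, Matrix.mulVec_diagonal, Finset.mul_sum]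
    refine Finset.sum_le_sum fun i _ => ?_
    have hp : 0 < S i i := hS.diag_pos
    calc √(S i i) * x i * (√(S i i) * x i) = √(S i i) ^ 2 * (x i * x i) := by ring
      _ = S i i * (x i * x i) := by rw [Real.sq_sqrt hp.le]
      _ ≤ _ := mul_le_mul_of_nonneg_right (le_maxVar S i) (mul_self_nonneg _)

/-! ### Edge supports -/

open Classical in
lemma sum_adj_eq_two_mul_numEdges (E : SimpleGraph (Fin p)) :
    ∑ i, ∑ j, (if E.Adj i j then (1 : ℝ) else 0) = 2 * numEdges E := by
  have h := E.sum_degrees_eq_twice_card_edges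
  have hc : numEdges E = E.edgeFinset.card := by
    rw [numEdges, Set.ncard_eq_toFinset_card', SimpleGraph.edgeFinset]
  rw [hc]
  have h2 : (∑ v, (E.degree v : ℝ)) = 2 * E.edgeFinset.card := by exact_mod_cast h
  rw [← h2]
  refine Finset.sum_congr rfl fun i _ => ?_
  rw [Finset.sum_boole, ← SimpleGraph.card_neighborFinset_eq_degree]
  congr 2
  ext j
  simp

lemma one_le_numEdges {E : SimpleGraph (Fin p)} {i j : Fin p} (h : E.Adj i j) :
    1 ≤ numEdges E :=
  Nat.one_le_iff_ne_zero.2 fun h0 => by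
    have := (Set.ncard_eq_zero (Set.toFinite _)).1 h0
    exact (Set.eq_empty_iff_forall_notMem.1 this s(i, j)) h

open Classical in
/-- Linear functionals given by a matrix that is small on the edges, tested on matrices supported
on the edges and the diagonal. -/
lemma abs_trace_mul_le {E : SimpleGraph (Fin p)} {D F : Matrix (Fin p) (Fin p) ℝ}
    (hF : F.IsHermitian) (hF0 : ∀ i, F i i = 0) {δ : ℝ}
    (hδ : ∀ i j, E.Adj i j → |F i j| ≤ δ) (hD : ∀ i j, i ≠ j → ¬ E.Adj i j → D i j = 0) :
    |(D * F).trace| ≤ √(2 * numEdges E * δ ^ 2) * frobNorm D := by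
  let F' : Matrix (Fin p) (Fin p) ℝ := Matrix.of fun i j => if E.Adj i j then F i j else 0
  have h1 : (D * F).trace = ∑ i, ∑ j, D i j * F' i j := by
    rw [trace_mul_eq_sum hF]
    refine Finset.sum_congr rfl fun i _ => Finset.sum_congr rfl fun j _ => ?_
    simp only [F', Matrix.of_apply]
    split_ifs with h
    · rfl
    · rcases eq_or_ne i j with rfl | hij
      · rw [hF0]
      · rw [hD i j hij h, zero_mul, zero_mul]
  have h2 : frobNorm F' ≤ √(2 * numEdges E * δ ^ 2) := by
    refine Real.sqrt_le_sqrt ?_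
    rw [← sum_adj_eq_two_mul_numEdges, Finset.sum_mul]
    refine Finset.sum_le_sum fun i _ => ?_
    rw [Finset.sum_mul]
    refine Finset.sum_le_sum fun j _ => ?_
    simp only [F', Matrix.of_apply]
    split_ifs with h
    · rw [one_mul, ← sq_abs]
      exact pow_le_pow_left₀ (abs_nonneg _) (hδ i j h) 2
    · simp
  rw [h1, mul_comm]
  exact (abs_sum_mul_le_frobNorm D F').trans
    (mul_le_mul_of_nonneg_left h2 (frobNorm_nonneg D))

open Classical in
lemma keepEdges_isHermitian {A : Matrix (Fin p) (Fin p) ℝ} (hA : A.IsHermitian)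
    (G : SimpleGraph (Fin p)) : (keepEdges A G).IsHermitian := by
  refine Matrix.IsHermitian.ext fun i j => ?_
  have h := hA.apply i j
  simp only [star_trivial] at h ⊢
  have he : (j = i ∨ G.Adj j i) ↔ (i = j ∨ G.Adj i j) := by rw [eq_comm, G.adj_comm]
  simp only [keepEdges, Matrix.of_apply, h]
  exact if_congr he rfl rfl

lemma keepEdges_eq_zero (A : Matrix (Fin p) (Fin p) ℝ) {G : SimpleGraph (Fin p)} {i j : Fin p}
    (hij : i ≠ j) (h : ¬ G.Adj i j) : keepEdges A G i j = 0 := by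
  simp [keepEdges, hij, h]

lemma corrMatrix_isHermitian {S : Matrix (Fin p) (Fin p) ℝ} (hS : S.IsHermitian) :
    (corrMatrix S).IsHermitian := by
  refine Matrix.IsHermitian.ext fun i j => ?_
  have h := hS.apply i j
  simp only [star_trivial] at h ⊢
  rw [corrMatrix_apply, corrMatrix_apply, h, mul_comm (√(S j j))]

lemma sampleCov_isHermitian (x : Fin n → EuclideanSpace ℝ (Fin p)) :
    (sampleCov x).IsHermitian := by
  refine Matrix.IsHermitian.ext fun i j => ?_
  simp only [star_trivial, sampleCov, Matrix.of_apply, mul_comm]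

/-- The rate of the constrained maximum likelihood estimator, for a sample whose correlations are
close to those of `S` on the edges of `E`. -/
theorem exists_isMLE_of_abs_corr_sub_le (hp : 1 ≤ p) (hn : 0 < n) {S : Matrix (Fin p) (Fin p) ℝ}
    (hS : S.PosDef) {Mlow Mupp : ℝ} (hM0 : 0 < Mlow) (hMlow : Mlow ≤ 1) (hMM : Mlow ≤ Mupp)
    (hSM : ∀ x : Fin p → ℝ, Mlow * (x ⬝ᵥ x) ≤ x ⬝ᵥ (S *ᵥ x) ∧ x ⬝ᵥ (S *ᵥ x) ≤ Mupp * (x ⬝ᵥ x))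
    (hmax : Mlow ≤ maxVar S)
    {C3 ℓ b r : ℝ} (hC3 : 5 ≤ C3) (hℓ : 0 ≤ ℓ) (E : SimpleGraph (Fin p))
    (hr : r = max (√(2 * numEdges E * ℓ / n)) b)
    (hbias : frobNorm (keepEdges S⁻¹ (ciGraph S⁻¹ ⊓ E) - S⁻¹) ≤ b)
    (hsize : 144 * maxVar S ^ 2 / Mlow ^ 2 * (4 * C3 + 13 * Mupp / (12 * minVar S)) ^ 2 * r ^ 2 ≤ 1)
    (x : Fin n → EuclideanSpace ℝ (Fin p)) (hpos : ∀ i, 0 < sampleCov x i i)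
    (hclose : ∀ i j, E.Adj i j →
      |corrMatrix (sampleCov x) i j - corrMatrix S i j| ≤ 16 * √(ℓ / n)) :
    ∃ Om, IsMLE E (corrMatrix (sampleCov x)) Om ∧
      (∀ Om', IsMLE E (corrMatrix (sampleCov x)) Om' → Om' = Om) ∧
      frobNorm (Om - (corrMatrix S)⁻¹) ≤
        (9 * maxVar S ^ 2 / (2 * Mlow ^ 2) * (4 * C3 + 13 * Mupp / (12 * minVar S)) + 1) * r := by
  have hmv := minVar_pos hS hp
  have hxv : 0 < maxVar S := hM0.trans_le hmax
  have hn' : (0 : ℝ) < n := by positivity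
  set U := maxVar S / Mlow with hU
  set V := Mupp / minVar S with hV
  have hV0 : 0 ≤ V := div_nonneg (hM0.le.trans hMM) hmv.le
  have hU1 : 1 ≤ U := (one_le_div hM0).2 hmax
  -- The normalization `Mlow ≤ 1` enters here: rescaling multiplies the bias by `maxVar S`, which U
  -- absorbs.
  have hsU : maxVar S ≤ U := by
    rw [hU, le_div_iff₀ hM0]
    exact mul_le_of_le_one_right hxv.le hMlow
  have hK : 4 * C3 + 13 * Mupp / (12 * minVar S) = 4 * C3 + 13 / 12 * V := by
    rw [hV]; field_simp
  have hr0 : 0 ≤ r := hr ▸ le_max_of_le_left (Real.sqrt_nonneg _)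
  have hbr : b ≤ r := hr ▸ le_max_right _ _
  have hsize' : U * r * (240 + 13 * V) ≤ 1 := by
    have e : 144 * maxVar S ^ 2 / Mlow ^ 2 = 144 * U ^ 2 := by rw [hU, div_pow]; ring
    rw [e, hK] at hsize
    have h1 : (U * r * (12 * (4 * C3 + 13 / 12 * V))) ^ 2 ≤ 1 := by linarith
    have h2 : U * r * (12 * (4 * C3 + 13 / 12 * V)) ≤ 1 :=
      (sq_le_one_iff₀ (by positivity)).1 h1
    -- Here 12 = √144, and 48 · `C3` ≥ 240 because `C3` ≥ 5.
    have h3 : U * r * (240 + 13 * V) ≤ U * r * (12 * (4 * C3 + 13 / 12 * V)) :=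
      mul_le_mul_of_nonneg_left (by linarith) (by positivity)
    linarith
  have hQ := corrMatrix_posDef hS
  have hmle : ∃ Om, IsMLE E (corrMatrix (sampleCov x)) Om ∧
      (∀ Om', IsMLE E (corrMatrix (sampleCov x)) Om' → Om' = Om) ∧
      frobNorm (Om - (corrMatrix S)⁻¹) ≤ (55 + 2 * V) * U ^ 2 * r := by
    refine exists_isMLE_frobNorm_le
      (G := corrMatrix (sampleCov x))
      (A₀ := sdMatrix S * keepEdges S⁻¹ (ciGraph S⁻¹ ⊓ E) * sdMatrix S) hQ E hU1 hV0 hr0 hsU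
      (dotProduct_self_le_corr hS hM0 (fun x => (hSM x).1) hxv.le)
      (corr_le_dotProduct_self hS (hM0.le.trans hMM) (fun x => (hSM x).2) hmv) hsize' ?_ ?_ ?_ ?_
    · have h := Matrix.isHermitian_mul_mul_conjTranspose (sdMatrix S)
        (keepEdges_isHermitian hS.inv.1 (ciGraph S⁻¹ ⊓ E))
      rwa [Matrix.conjTranspose_eq_transpose_of_trivial,
        show (sdMatrix S)ᵀ = sdMatrix S from Matrix.diagonal_transpose _] at h
    · intro i j hij hE
      rw [sdMatrix_mul_mul_apply, keepEdges_eq_zero S⁻¹ (G := ciGraph S⁻¹ ⊓ E) hij (fun h => hE h.2), mul_zero, zero_mul]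
    · rw [corrMatrix_inv hS, ← sub_mul, ← mul_sub]
      exact (frobNorm_sdMatrix_le hS hxv.le _).trans
        (mul_le_mul_of_nonneg_left (hbias.trans hbr) hxv.le)
    · intro D hD
      refine (abs_trace_mul_le ((corrMatrix_isHermitian (sampleCov_isHermitian x)).sub hQ.1) ?_
        (fun i j hij => hclose i j hij) hD).trans
        (mul_le_mul_of_nonneg_right ?_ (frobNorm_nonneg D))
      · intro i
        rw [Matrix.sub_apply, corrMatrix_self (hpos i), corrMatrix_self hS.diag_pos, sub_self]
      · have e : 2 * (numEdges E : ℝ) * (16 * √(ℓ / n)) ^ 2 = 16 ^ 2 * (2 * numEdges E * ℓ / n) := by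
          rw [mul_pow, Real.sq_sqrt (by positivity)]
          ring
        rw [e, Real.sqrt_mul (by norm_num), Real.sqrt_sq (by norm_num), hr]
        exact mul_le_mul_of_nonneg_left (le_max_left _ _) (by norm_num)
  obtain ⟨Om, h1, h2, h3⟩ := hmle
  refine ⟨Om, h1, h2, h3.trans (mul_le_mul_of_nonneg_right ?_ hr0)⟩
  have e : 9 * maxVar S ^ 2 / (2 * Mlow ^ 2) = 9 / 2 * U ^ 2 := by rw [hU, div_pow]; ring
  rw [e, hK]
  have h4 : U ^ 2 * (55 + 2 * V) ≤ U ^ 2 * (9 / 2 * (4 * C3 + 13 / 12 * V)) :=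
    mul_le_mul_of_nonneg_left (by linarith) (sq_nonneg U)
  linarith

end GaussGraph

namespace GaussGraph

variable {p n : ℕ} {Ω : Type*} [MeasurableSpace Ω] {P : Measure Ω}

/-! ### The probability of the exceptional set -/

/-- Removing a measurable hull of the same measure avoids any measurability claim about the bad set.
-/
lemma exists_measurableSet_diff [IsProbabilityMeasure P] {Ev Bad : Set Ω} (hEv : MeasurableSet Ev)
    {a b : ℝ} (ha : 1 - a ≤ P.real Ev) (hb : P.real Bad ≤ b) :
    ∃ A, MeasurableSet A ∧ 1 - (a + b) ≤ P.real A ∧ ∀ ω ∈ A, ω ∈ Ev ∧ ω ∉ Bad := by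
  refine ⟨Ev \ toMeasurable P Bad, hEv.diff (measurableSet_toMeasurable P Bad), ?_,
    fun ω hω => ⟨hω.1, fun h => hω.2 (subset_toMeasurable P Bad h)⟩⟩
  have h1 := le_measureReal_sdiff (μ := P) (s₁ := Ev) (s₂ := toMeasurable P Bad)
  have h2 : P.real (toMeasurable P Bad) = P.real Bad := by
    rw [measureReal_def, measure_toMeasurable, measureReal_def]
  linarith

/-- 49/8 ≥ 6 makes the exponential at most p⁻⁶, and 4 ≤ p² absorbs the constant; this is where p ≥ 2
matters. -/
lemma four_mul_sq_mul_exp_le {L m t : ℝ} (hp : 2 ≤ p) (hL : Real.log p ≤ L)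
    (ht : m * t ^ 2 = 49 * L) :
    4 * (p : ℝ) ^ 2 * Real.exp (-(m * t ^ 2 / 8)) ≤ 1 / (p : ℝ) ^ 2 := by
  have hp2 : (2 : ℝ) ≤ p := by exact_mod_cast hp
  have hp0 : (0 : ℝ) < p := by linarith
  have hlog : 0 ≤ Real.log p := Real.log_nonneg (by linarith)
  have h1 : Real.exp (-(m * t ^ 2 / 8)) ≤ ((p : ℝ) ^ 6)⁻¹ := by
    rw [← Real.exp_log (inv_pos.2 (pow_pos hp0 6)), Real.log_inv, Real.log_pow]
    refine Real.exp_le_exp.2 ?_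
    push_cast
    linarith
  calc 4 * (p : ℝ) ^ 2 * Real.exp (-(m * t ^ 2 / 8)) ≤ p ^ 2 * (p : ℝ) ^ 2 * ((p : ℝ) ^ 6)⁻¹ := by
        refine mul_le_mul (mul_le_mul_of_nonneg_right ?_ (sq_nonneg _)) h1 (Real.exp_pos _).le
          (by positivity)
        nlinarith
    _ = 1 / (p : ℝ) ^ 2 := by field_simp

lemma measureReal_exists_apply_eq_zero {X : Fin n → Ω → EuclideanSpace ℝ (Fin p)}
    {S : Matrix (Fin p) (Fin p) ℝ} (hS : S.PosDef)
    (hX : ∀ r, HasLaw (X r) (multivariateGaussian 0 S) P) :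
    P.real {ω | ∃ r i, X r ω i = 0} = 0 := by
  have h : ∀ᵐ ω ∂P, ∀ r i, X r ω i ≠ 0 := by
    refine ae_all_iff.2 fun r => ae_all_iff.2 fun i => ?_
    have h1 : HasLaw (fun ω => X r ω i) (gaussianReal 0 (S i i).toNNReal) P := by
      have h2 := (measurePreserving_eval_multivariateGaussian (μ := 0) (i := i)
        hS.posSemidef).fun_comp_hasLaw (hX r)
      simpa only [PiLp.zero_apply] using h2
    have hv : (S i i).toNNReal ≠ 0 := (Real.toNNReal_pos.2 hS.diag_pos).ne'
    have := nullSingletonClass_gaussianReal (μ := 0) hv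
    refine (h1.ae_iff (p := fun y => y ≠ 0) (by fun_prop)).2 ?_
    exact measure_eq_zero_iff_ae_notMem.1 (measure_singleton (0 : ℝ))
  rw [measureReal_def, measure_eq_zero_iff_ae_notMem.2, ENNReal.toReal_zero]
  filter_upwards [h] with ω hω
  rintro ⟨r, i, h0⟩
  exact hω r i h0

lemma sampleCov_self_pos (hn : 0 < n) {x : Fin n → EuclideanSpace ℝ (Fin p)}
    (hx : ∀ r i, x r i ≠ 0) (i : Fin p) : 0 < sampleCov x i i := by
  have hn' : (0 : ℝ) < n := by positivity
  refine div_pos (Finset.sum_pos (fun r _ => mul_self_pos.2 (hx r i)) ⟨⟨0, hn⟩, by simp⟩) hn'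

lemma abs_corrMatrix_le_one {Y : Ω → EuclideanSpace ℝ (Fin p)} {S : Matrix (Fin p) (Fin p) ℝ}
    (hS : S.PosDef) (hY : HasLaw Y (multivariateGaussian 0 S) P) (i j : Fin p) :
    |corrMatrix S i j| ≤ 1 := by
  have h1 := (hasLaw_normalized_pair hS hY i j true).1
  have h2 := (hasLaw_normalized_pair hS hY i j false).1
  simp only [boolSign, if_true, Bool.false_eq_true, if_false] at h1 h2
  exact abs_le.2 ⟨by linarith, by linarith⟩

/-- Turns the sample-size condition into a bound on the squared rate. Splitting on which term
attains the maximum avoids a sign condition on `C`. -/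
lemma mul_max_sq_le_one {c a β C m : ℝ} (hc : 0 ≤ c) (ha : 0 ≤ a) (hβ : 0 ≤ β)
    (hm : m > c * max a (C ^ 2 * β)) : c * max (√(a / m)) (C * √(β / m)) ^ 2 ≤ 1 := by
  have hm0 : 0 < m := (mul_nonneg hc (le_max_of_le_left ha)).trans_lt hm
  have h : max (√(a / m)) (C * √(β / m)) ^ 2 ≤ max a (C ^ 2 * β) / m := by
    rcases max_choice (√(a / m)) (C * √(β / m)) with h | h <;> rw [h]
    · rw [Real.sq_sqrt (by positivity)]
      exact div_le_div_of_nonneg_right (le_max_left _ _) hm0.le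
    · rw [mul_pow, Real.sq_sqrt (by positivity), mul_div_assoc']
      exact div_le_div_of_nonneg_right (le_max_right _ _) hm0.le
  refine (mul_le_mul_of_nonneg_left h hc).trans ?_
  rw [mul_div_assoc', div_le_one hm0]
  exact hm.le

lemma le_maxVar_of_quadratic_le (hp : 0 < p) {S : Matrix (Fin p) (Fin p) ℝ} {a : ℝ}
    (h : ∀ x : Fin p → ℝ, a * (x ⬝ᵥ x) ≤ x ⬝ᵥ (S *ᵥ x)) : a ≤ maxVar S := by
  have h1 := h (Pi.single ⟨0, hp⟩ 1)
  simp at h1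
  exact h1.trans (le_maxVar S _)

end GaussGraph

/-! ### Combining the deterministic rate with the concentration event -/

open GaussGraph in
theorem mainTheorem6
    -- the triangular array
    (p : ℕ → ℕ) (hp : ∀ n, 1 ≤ p n)
    (Sig : ∀ n, Matrix (Fin (p n)) (Fin (p n)) ℝ)
    (Mlow Mupp : ℝ) (hA1 : AssumptionA1 p Sig) (hA2 : AssumptionA2 p Sig Mlow Mupp)
    (hMlow : Mlow ≤ 1)
    -- the constants
    (d L Cbias C3 : ℝ) (hC3 : 4 * √(5 / 3) ≤ C3)
    -- an i.i.d. sample of size `n`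
    (n : ℕ)
    {Ω : Type*} [MeasurableSpace Ω] (P : Measure Ω) [IsProbabilityMeasure P]
    (X : Fin n → Ω → EuclideanSpace ℝ (Fin (p n)))
    (hXlaw : ∀ r, HasLaw (X r) (multivariateGaussian 0 (Sig n)) P)
    (hXind : iIndepFun X P)
    -- the event and the (possibly random) edge set
    (Ev : Set Ω) (hEv : MeasurableSet Ev) (hEvP : 1 - d / (p n : ℝ) ^ 2 ≤ P.real Ev)
    (E : Ω → SimpleGraph (Fin (p n)))
    (hElin : ∀ ω ∈ Ev, (numEdges (E ω) : ℝ) ≤ L * essSparsity n (Sig n)⁻¹)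
    (hbias : ∀ ω ∈ Ev,
      frobNorm (keepEdges (Sig n)⁻¹ (ciGraph (Sig n)⁻¹ ⊓ E ω) - (Sig n)⁻¹) ≤
        Cbias * √(2 * essSparsity n (Sig n)⁻¹ * Real.log (p n) / n))
    -- the sample size
    (hn : ∀ ω ∈ Ev,
      (n : ℝ) > 144 * maxVar (Sig n) ^ 2 / Mlow ^ 2 *
        (4 * C3 + 13 * Mupp / (12 * minVar (Sig n))) ^ 2 *
        max (2 * numEdges (E ω) * Real.log (max n (p n) : ℕ))
          (Cbias ^ 2 * (2 * essSparsity n (Sig n)⁻¹ * Real.log (p n))))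
    (M : ℝ)
    (hM : M = 9 * maxVar (Sig n) ^ 2 / (2 * Mlow ^ 2) *
      (4 * C3 + 13 * Mupp / (12 * minVar (Sig n)))) :
    ∃ A : Set Ω, MeasurableSet A ∧ 1 - (d + 1) / (p n : ℝ) ^ 2 ≤ P.real A ∧
      ∀ ω ∈ A, ∃ Om : Matrix (Fin (p n)) (Fin (p n)) ℝ,
        IsMLE (E ω) (corrMatrix (sampleCov fun r => X r ω)) Om ∧
        (∀ Om', IsMLE (E ω) (corrMatrix (sampleCov fun r => X r ω)) Om' → Om' = Om) ∧
        frobNorm (Om - (corrMatrix (Sig n))⁻¹) ≤ (M + 1) *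
          max (√(2 * numEdges (E ω) * Real.log (max n (p n) : ℕ) / n))
            (Cbias * √(2 * essSparsity n (Sig n)⁻¹ * Real.log (p n) / n)) := by
  obtain ⟨hM0, hMM, heig, -⟩ := hA2
  obtain ⟨hH, hab⟩ := heig n
  have hS : (Sig n).PosDef :=
    hH.posDef_iff_eigenvalues_pos.2 fun i => hM0.trans_le (hab i).1
  have hSM := dotProduct_mulVec_bounds hH hab
  have hmax : Mlow ≤ maxVar (Sig n) := le_maxVar_of_quadratic_le (hp n) fun x => (hSM x).1
  have hmv := minVar_pos hS (hp n)
  have hC5 : 5 ≤ C3 := by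
    have h1 : (5 / 4 : ℝ) ≤ √(5 / 3) := Real.le_sqrt_of_sq_le (by norm_num)
    linarith
  set L' : ℝ := Real.log (max n (p n) : ℕ) with hL'
  have hp1 : (1 : ℝ) ≤ p n := by exact_mod_cast hp n
  have hlogp : 0 ≤ Real.log (p n) := Real.log_nonneg hp1
  have hLp : Real.log (p n) ≤ L' :=
    Real.log_le_log (by linarith) (by exact_mod_cast le_max_right n (p n))
  have hL0 : 0 ≤ L' := hlogp.trans hLp
  have hK : 20 ≤ 4 * C3 + 13 * Mupp / (12 * minVar (Sig n)) := by
    have : 0 ≤ 13 * Mupp / (12 * minVar (Sig n)) :=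
      div_nonneg (by linarith) (by linarith)
    linarith
  set K : ℝ := 4 * C3 + 13 * Mupp / (12 * minVar (Sig n)) with hKdef
  have hc0 : 0 ≤ 144 * maxVar (Sig n) ^ 2 / Mlow ^ 2 * K ^ 2 := by positivity
  have hnpos : ∀ ω ∈ Ev, 0 < n := fun ω hω => by
    have h1 := hn ω hω
    have h2 : (0 : ℝ) ≤ 144 * maxVar (Sig n) ^ 2 / Mlow ^ 2 * K ^ 2 *
        max (2 * numEdges (E ω) * L')
          (Cbias ^ 2 * (2 * essSparsity n (Sig n)⁻¹ * Real.log (p n))) :=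
      mul_nonneg hc0 (le_max_of_le_left (by positivity))
    exact_mod_cast h2.trans_lt h1
  have main : ∀ ω ∈ Ev, (∀ i, 0 < sampleCov (fun r => X r ω) i i) →
      (∀ i j, (E ω).Adj i j → |corrMatrix (sampleCov fun r => X r ω) i j -
        corrMatrix (Sig n) i j| ≤ 16 * √(L' / n)) →
      ∃ Om, IsMLE (E ω) (corrMatrix (sampleCov fun r => X r ω)) Om ∧
        (∀ Om', IsMLE (E ω) (corrMatrix (sampleCov fun r => X r ω)) Om' → Om' = Om) ∧
        frobNorm (Om - (corrMatrix (Sig n))⁻¹) ≤ (M + 1) *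
          max (√(2 * numEdges (E ω) * L' / n))
            (Cbias * √(2 * essSparsity n (Sig n)⁻¹ * Real.log (p n) / n)) := by
    intro ω hω hpos hclose
    rw [hM]
    exact exists_isMLE_of_abs_corr_sub_le (hp n) (hnpos ω hω) hS hM0 hMlow hMM hSM hmax hC5 hL0
      (E ω) rfl (hbias ω hω) (mul_max_sq_le_one hc0 (by positivity) (by positivity) (hn ω hω)) _
      hpos hclose
  have hsplit : 1 - (d + 1) / (p n : ℝ) ^ 2 = 1 - (d / (p n : ℝ) ^ 2 + 1 / (p n : ℝ) ^ 2) := by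
    rw [add_div]
  -- A single outcome with an edge forces p ≥ 2 and a deterministic lower bound on `n`, valid for
  -- all outcomes. Without edges neither is available, but entrywise closeness is vacuous.
  by_cases hE : ∃ ω ∈ Ev, 1 ≤ numEdges (E ω)
  · obtain ⟨ω₀, hω₀, hE₀⟩ := hE
    have hn0 := hnpos ω₀ hω₀
    have hn' : (0 : ℝ) < n := by positivity
    have hp2 : 2 ≤ p n := by
      by_contra hlt
      have : Subsingleton (Fin (p n)) := Fin.subsingleton_iff_le_one.2 (by omega)
      have hbot : E ω₀ = ⊥ := Subsingleton.elim _ _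
      simp [numEdges, hbot] at hE₀
    -- 3136 = 56², so that t = 7√(L'/n) ≤ 1/8. The factor 7 also turns the correlation error 16t/7
    -- into the required 16√(L'/n).
    have hsize : 3136 * L' ≤ n := by
      have h1 : (1 : ℝ) ≤ maxVar (Sig n) ^ 2 / Mlow ^ 2 := by
        rw [one_le_div (by positivity)]
        exact pow_le_pow_left₀ hM0.le hmax 2
      have h2 : (400 : ℝ) ≤ K ^ 2 := by nlinarith
      have h3 : 57600 ≤ 144 * maxVar (Sig n) ^ 2 / Mlow ^ 2 * K ^ 2 := by
        rw [mul_div_assoc]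
        nlinarith
      have h4 : L' ≤ 2 * numEdges (E ω₀) * L' := by
        have : (1 : ℝ) ≤ numEdges (E ω₀) := by exact_mod_cast hE₀
        nlinarith
      have h5 := hn ω₀ hω₀
      have h6 := h4.trans (le_max_left _
        (Cbias ^ 2 * (2 * essSparsity n (Sig n)⁻¹ * Real.log (p n))))
      have h7 := mul_le_mul h3 h6 hL0 hc0
      linarith
    have htL : √(L' / n) ≤ 1 / 56 := by
      refine Real.sqrt_le_iff.2 ⟨by norm_num, ?_⟩
      rw [div_le_iff₀ hn']
      linarith
    have ht0 : 0 ≤ 7 * √(L' / n) := by positivity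
    have ht8 : 7 * √(L' / n) ≤ 1 / 8 := by linarith
    have hb := (measureReal_not_pairsConcentrated_le hS hXlaw hXind ht0 (by linarith)).trans
      (four_mul_sq_mul_exp_le hp2 hLp (by
        rw [mul_pow, Real.sq_sqrt (by positivity)]
        field_simp
        ring))
    obtain ⟨A, hA, hAP, hAω⟩ := exists_measurableSet_diff hEv hEvP hb
    refine ⟨A, hA, hsplit.trans_le hAP, fun ω hω => ?_⟩
    have hgood : PairsConcentrated (Sig n) (7 * √(L' / n)) fun r => X r ω :=
      not_not.1 (hAω ω hω).2
    obtain ⟨h1, h2⟩ := hgood.corrMatrix_sampleCov hS hn0 ht8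
      (abs_corrMatrix_le_one hS (hXlaw ⟨0, hn0⟩))
    exact main ω (hAω ω hω).1 h1 fun i j _ => (h2 i j).trans_eq (by ring)
  -- Only unit diagonals of the sample correlation matrix are needed, so a null set suffices as the
  -- bad event; this covers p = 1.
  · have hb : P.real {ω | ∃ r i, X r ω i = 0} ≤ 1 / (p n : ℝ) ^ 2 := by
      rw [measureReal_exists_apply_eq_zero hS hXlaw]
      positivity
    obtain ⟨A, hA, hAP, hAω⟩ := exists_measurableSet_diff hEv hEvP hb
    refine ⟨A, hA, hsplit.trans_le hAP, fun ω hω => main ω (hAω ω hω).1 ?_ ?_⟩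
    · exact sampleCov_self_pos (hnpos ω (hAω ω hω).1) fun r i h => (hAω ω hω).2 ⟨r, i, h⟩
    · exact fun i j hij => absurd ⟨ω, (hAω ω hω).1, one_le_numEdges hij⟩ hE
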